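/- **Setting.** Consider one round of a prepare-and-measure protocol with finite-dimensional systems $A,A',B$ ($B\neq 0$). With probability $\gamma\in(0,1]$ Alice makes it a test round and prepares a unit vector $|\xi^{\mathrm t}\rangle_{AA'}$; otherwise it is a generation round and she prepares a unit vector $|\xi^{\mathrm g}\rangle_{AA'}$. She keeps $A$ and sends $A'$ through a channel $A'\to B$ with Choi matrix $J$, i.e. $J\succeq 0$ on $A'B$ with $\operatorname{tr}_B J=\mathbb 1_{A'}$. The resulting states on $AB$ are $$\rho^{\mathrm g/\mathrm t}_J=\operatorname{tr}_{A'}\big[(\mathbb 1_A\otimes J)(|\xi^{\mathrm g/\mathrm t}\rangle\langle\xi^{\mathrm g/\mathrm t}|^{T_{A'}}\otimes\mathbb 1_B)\big].$$ Alice and Bob measure finite POVMs on $A$ and $B$ (Alice's may depend on the type of round). In a test round they record a value $c\in\mathcal C$, a function of their outcomes ($\mathcal C$ is finite and does not contain the symbol $\perp$ of generation rounds); $\mathbf\Phi[\rho]\in\mathbb R^{\mathcal C}$ is the vector of probabilities $\Phi_c[\rho]$ of the values $c$, given a test round with state $\rho$. In a generation round they announce a function $I$ of their outcomes, and Alice computes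 a key value $S$, from a finite alphabet of size $d$, from her outcome and $I$. In a test round all outcomes are public. $W(\rho)$ is the base-2 conditional von Neumann entropy $H(S|IE)$ of the round when Eve holds a purification $E$ of the generation-round state $\rho$, that is, $W(\rho)=(1-\gamma)\,H(S|IE)$ with the entropy evaluated for a generation round. For $\mathbf q\in\mathbb R^{\mathcal C}$ let $r_{\mathrm{cross}}(\mathbf q)=\inf\{W(\rho^{\mathrm g}_J): J \text{ a Choi matrix},\ \mathbf\Phi[\rho^{\mathrm t}_J]=\mathbf q\}$, with value $+\infty$ if there is no such $J$. A *crossover min-tradeoff function* is an affine function $g(\mathbf q)=\mathbf g\cdot\mathbf q+k_g$ with $g(\mathbf q)\le r_{\mathrm{cross}}(\mathbf q)$ for all probability distributions $\mathbf q$ on $\mathcal C$; $\mathbf g$ is its gradient. Fix $1<\alpha<2$ and $\kappa\in\mathbb N$, and put $\varphi_0=\frac{\alpha-1}{2-\alpha}\frac{\ln 2}{2}\frac1\gamma$, $\varphi_1=\frac{\alpha-1}{2-\alpha}\frac{\ln 2}{2}\frac{2\log_2(1+2d^\kappa)}{\sqrt\gamma}$, $$\hat T(\mathbf g)=\varphi_0(\max\mathbf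 g-\min\mathbf g)^2+\varphi_1(\max\mathbf g-\min\mathbf g),\qquad s(x)=\begin{cases}\frac{(x-\varphi_1)^2}{4\varphi_0}&x\ge\varphi_1\\0&\text{otherwise,}\end{cases}$$ and $\hat T^*(\boldsymbol\lambda)=s(\|\boldsymbol\lambda\|_1/2)$ if $\sum_c\lambda_c=0$, $\hat T^*(\boldsymbol\lambda)=+\infty$ otherwise. **Theorem.** Let $\mathbf q^{\mathrm{hon}}$ be a probability distribution on $\mathcal C$ and let $r_{\mathrm{best}}=\sup_g\big(g(\mathbf q^{\mathrm{hon}})-\hat T(\mathbf g)\big)$, the supremum being over all crossover min-tradeoff functions $g$. Below, $J$ ranges over all Choi matrices and $\boldsymbol\lambda,\boldsymbol\mu$ over $\mathbb R^{\mathcal C}$; values are in $[-\infty,+\infty]$. 1. $$r_{\mathrm{best}}=\inf_{J,\boldsymbol\lambda}\big\{W(\rho^{\mathrm g}_J)+\hat T^*(\boldsymbol\lambda)\ :\ \mathbf q^{\mathrm{hon}}-\mathbf\Phi[\rho^{\mathrm t}_J]-\boldsymbol\lambda=\mathbf 0\big\},$$ where $J\mapsto W(\rho^{\mathrm g}_J)$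 is convex on the convex set of Choi matrices, and $\boldsymbol\lambda\mapsto s(\|\boldsymbol\lambda\|_1/2)$ is convex on $\{\sum_c\lambda_c=0\}$. 2. $$r_{\mathrm{best}}=\inf_{J,\boldsymbol\lambda,\boldsymbol\mu}\Big\{W(\rho^{\mathrm g}_J)+s\Big(\sum_c\mu_c/2\Big)\ :\ \mathbf q^{\mathrm{hon}}-\mathbf\Phi[\rho^{\mathrm t}_J]-\boldsymbol\lambda=\mathbf 0,\ -\boldsymbol\mu\le\boldsymbol\lambda\le\boldsymbol\mu\Big\},$$ where $\boldsymbol\mu\mapsto s(\sum_c\mu_c/2)$ is convex and differentiable on $\mathbb R^{\mathcal C}$. 3. Let $L(\rho,\boldsymbol\mu)$ be a real affine function with $L(\rho^{\mathrm g}_J,\boldsymbol\mu)\le W(\rho^{\mathrm g}_J)+s(\sum_c\mu_c/2)$ for all Choi matrices $J$ and all $\boldsymbol\mu\ge\mathbf 0$, and let $r_{\mathrm{SDP}}$ be the value of the semidefinite program $$\inf_{J,\boldsymbol\lambda,\boldsymbol\mu}\big\{L(\rho^{\mathrm g}_J,\boldsymbol\mu)\ :\ \mathbf q^{\mathrm{hon}}-\mathbf\Phi[\rho^{\mathrm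 t}_J]-\boldsymbol\lambda=\mathbf 0,\ -\boldsymbol\mu\le\boldsymbol\lambda\le\boldsymbol\mu\big\}.$$ Consider its Lagrange dual for the equality constraint: maximize over $\mathbf g\in\mathbb R^{\mathcal C}$ the function $$D(\mathbf g)=\inf\big\{L(\rho^{\mathrm g}_J,\boldsymbol\mu)+\mathbf g\cdot(\mathbf q^{\mathrm{hon}}-\mathbf\Phi[\rho^{\mathrm t}_J]-\boldsymbol\lambda)\ :\ J\text{ a Choi matrix},\ -\boldsymbol\mu\le\boldsymbol\lambda\le\boldsymbol\mu\big\}.$$ Then a maximizer exists, and every maximizer $\mathbf g^\star$ satisfies $D(\mathbf g^\star)=r_{\mathrm{SDP}}$ and is the gradient of a crossover min-tradeoff function $g^\star$ with $$g^\star(\mathbf q^{\mathrm{hon}})-\hat T(\mathbf g^\star)\ \ge\ r_{\mathrm{SDP}}.$$ -/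

import Mathlib

open scoped Matrix Kronecker ComplexOrder BigOperators

noncomputable section

/-! ### Finite-dimensional quantum objects -/

section Quantum

/-- A positive-operator-valued measure with finitely many outcomes. -/
def IsPOVM {K X : Type*} [Fintype K] [DecidableEq K] [Fintype X]
    (M : X → Matrix K K ℂ) : Prop :=
  (∀ x, (M x).PosSemidef) ∧ ∑ x, M x = 1

/-- Base-2 von Neumann entropy `-tr (ω log₂ ω)` of a positive semidefinite matrix, through the
continuous functional calculus (with `0 log 0 = 0`). -/
def vnEntropy {K : Type*} [Fintype K] [DecidableEq K] (ω : Matrix K K ℂ) : ℝ :=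
  (cfc Real.negMulLog ω).trace.re / Real.log 2

/-- The conditional entropy `H(S|IE) = H(SIE) - H(IE)` of the state
`∑ s i, |s⟩⟨s| ⊗ |i⟩⟨i| ⊗ ω s i`, which is classical on `S` and `I`; here `ω s i` is the
subnormalized state of `E`. -/
def cqCondEntropy {E I S : Type*} [Fintype E] [DecidableEq E] [Fintype I] [DecidableEq I]
    [Fintype S] [DecidableEq S] (ω : S → I → Matrix E E ℂ) : ℝ :=
  vnEntropy (Matrix.blockDiagonal fun si : S × I => ω si.1 si.2)
    - vnEntropy (Matrix.blockDiagonal fun i : I => ∑ s, ω s i)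

/-- The vector `∑ k e, Ψ k e |k⟩ ⊗ |e⟩` purifies `Ψ * Ψᴴ`.  This is the subnormalized state
`tr_K ((N ⊗ 1) |Ψ⟩⟨Ψ|)` that the holder of `E` has when the system `K` is measured and the outcome
belonging to the POVM element `N` occurs. -/
def purifierState {K E : Type*} [Fintype K]
    (Ψ : Matrix K E ℂ) (N : Matrix K K ℂ) : Matrix E E ℂ :=
  (Ψᴴ * N * Ψ)ᵀ

/-- The canonical purification of a positive semidefinite `ρ`: the vector with coefficient
matrix `√ρ`. All purifications agree up to an isometry on the purifying system. -/
def canonicalPurification {K : Type*} [Fintype K] [DecidableEq K] (ρ : Matrix K K ℂ) :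
    Matrix K K ℂ :=
  cfc Real.sqrt ρ

/-- Partial transpose on the second tensor factor. -/
def partialTransposeSnd {K K' : Type*} (X : Matrix (K × K') (K × K') ℂ) :
    Matrix (K × K') (K × K') ℂ :=
  Matrix.of fun p q => X (p.1, q.2) (q.1, p.2)

/-- `J` is the Choi matrix of a channel from `A'` to `B`: positive semidefinite with
`tr_B J = 1`. -/
def IsChoi {A' B : Type*} [Fintype A'] [DecidableEq A'] [Fintype B]
    (J : Matrix (A' × B) (A' × B) ℂ) : Prop :=
  J.PosSemidef ∧ (Matrix.of fun k l : A' => ∑ b, J (k, b) (l, b)) = 1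

/-- `tr_{A'} ((1_A ⊗ J) (|ξ⟩⟨ξ|^{T_{A'}} ⊗ 1_B))`: the state on `AB` that results when the channel
with Choi matrix `J` acts on the `A'` part of `|ξ⟩`. -/
def outState {A A' B : Type*} [Fintype A] [DecidableEq A] [Fintype A'] [DecidableEq A']
    [Fintype B] [DecidableEq B] (ξ : A × A' → ℂ) (J : Matrix (A' × B) (A' × B) ℂ) :
    Matrix (A × B) (A × B) ℂ :=
  Matrix.of fun p q => ∑ k : A',
    (((1 : Matrix A A ℂ) ⊗ₖ J) *
      (partialTransposeSnd (Matrix.vecMulVec ξ (star ξ)) ⊗ₖ (1 : Matrix B B ℂ)).reindex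
        (Equiv.prodAssoc A A' B) (Equiv.prodAssoc A A' B)) (p.1, k, p.2) (q.1, k, q.2)

end Quantum

/-! ### One round of a prepare-and-measure protocol -/

/-- The data of a single round, in source-replacement form. With probability `γ` Alice makes it a
test round and prepares `ξt`, otherwise it is a generation round and she prepares `ξg`. She keeps
`A`, to be measured with her POVM for the type of round (`MAt` or `MAg`), and sends `A'`; Bob
measures the system `B` that he receives with `MB`. In a test round the value
`testValue x y : C` is recorded (`C` is the alphabet without the symbol `⊥` of generation rounds).
In a generation round `announce x y : I` is announced publicly, and Alice's raw key value is
`keyMap x i`. -/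
structure PMRound (A A' B X Y C I S : Type*)
    [Fintype A] [DecidableEq A] [Fintype A'] [Fintype B] [DecidableEq B]
    [Fintype X] [Fintype Y] where
  γ : ℝ
  γ_pos : 0 < γ
  γ_le_one : γ ≤ 1
  ξg : A × A' → ℂ
  ξt : A × A' → ℂ
  ξg_norm : ∑ p, ‖ξg p‖ ^ 2 = 1
  ξt_norm : ∑ p, ‖ξt p‖ ^ 2 = 1
  MAg : X → Matrix A A ℂ
  MAt : X → Matrix A A ℂ
  MB : Y → Matrix B B ℂ
  MAg_povm : IsPOVM MAg
  MAt_povm : IsPOVM MAt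
  MB_povm : IsPOVM MB
  testValue : X → Y → C
  announce : X → Y → I
  keyMap : X → I → S

namespace PMRound

variable {A A' B X Y C I S : Type*}
  [Fintype A] [DecidableEq A] [Fintype A'] [DecidableEq A'] [Fintype B] [DecidableEq B]
  [Fintype X] [Fintype Y] [Fintype C] [DecidableEq C]
  [Fintype I] [DecidableEq I] [Fintype S] [DecidableEq S]

/-- The state on `AB` in a generation round. -/
def ρg (P : PMRound A A' B X Y C I S) (J : Matrix (A' × B) (A' × B) ℂ) :
    Matrix (A × B) (A × B) ℂ :=
  outState P.ξg J

/-- The state on `AB` in a test round. -/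
def ρt (P : PMRound A A' B X Y C I S) (J : Matrix (A' × B) (A' × B) ℂ) :
    Matrix (A × B) (A × B) ℂ :=
  outState P.ξt J

/-- `Φ_c[ρ]`: the probability, conditioned on a test round, of recording the value `c`. -/
def Φ (P : PMRound A A' B X Y C I S) (ρ : Matrix (A × B) (A × B) ℂ) : C → ℝ :=
  fun c => ∑ x, ∑ y, if P.testValue x y = c then ((P.MAt x ⊗ₖ P.MB y) * ρ).trace.re else 0

/-- The POVM element on `AB`, in a generation round, for the key value `s` together with the
announcement `i`. -/
def keyElement (P : PMRound A A' B X Y C I S) (s : S) (i : I) : Matrix (A × B) (A × B) ℂ :=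
  ∑ x, ∑ y, if P.announce x y = i ∧ P.keyMap x i = s then P.MAg x ⊗ₖ P.MB y else 0

/-- `W(ρ)`: the entropy `H(S|IE)` of a round when Eve holds a purification `E` of the
generation-round state `ρ`. The public data show whether the round is a test round, and in a test
round they determine Alice's values, so that only generation rounds contribute: their
`H(S|IE)`, times their probability `1 - γ`. -/
def W (P : PMRound A A' B X Y C I S) (ρ : Matrix (A × B) (A × B) ℂ) : ℝ :=
  (1 - P.γ) * cqCondEntropy fun (s : S) (i : I) =>
    purifierState (canonicalPurification ρ) (P.keyElement s i)

/-! ### Crossover min-tradeoff functions -/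

/-- The crossover rate function, with value `+∞` where the optimization is infeasible. -/
def rCross (P : PMRound A A' B X Y C I S) (q : C → ℝ) : EReal :=
  ⨅ (J : Matrix (A' × B) (A' × B) ℂ) (_ : IsChoi J) (_ : P.Φ (P.ρt J) = q), (P.W (P.ρg J) : EReal)

/-- The affine function `q ↦ g ⬝ q + k` is a crossover min-tradeoff function: it is a lower bound
on the crossover rate function on all probability distributions. -/
def IsCrossoverMinTradeoff (P : PMRound A A' B X Y C I S) (g : C → ℝ) (k : ℝ) : Prop :=
  ∀ q ∈ stdSimplex ℝ C, ((g ⬝ᵥ q + k : ℝ) : EReal) ≤ P.rCross q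

/-- `φ₀ = (α-1)/(2-α) · (ln 2)/2 · 1/γ`. -/
def φ₀ (P : PMRound A A' B X Y C I S) (α : ℝ) : ℝ :=
  (α - 1) / (2 - α) * (Real.log 2 / 2) * (1 / P.γ)

/-- `φ₁ = (α-1)/(2-α) · (ln 2)/2 · 2 log₂(1 + 2 d^κ)/√γ`, where `d` is the size of the alphabet of
the key register `S`. -/
def φ₁ (P : PMRound A A' B X Y C I S) (α : ℝ) (κ : ℕ) : ℝ :=
  (α - 1) / (2 - α) * (Real.log 2 / 2) *
    (2 * Real.logb 2 (1 + 2 * (Fintype.card S : ℝ) ^ κ) / Real.sqrt P.γ)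

/-- The approximate second-order correction `T̂`, a function of the gradient `g`. -/
def That (P : PMRound A A' B X Y C I S) (α : ℝ) (κ : ℕ) (g : C → ℝ) : ℝ :=
  P.φ₀ α * ((⨆ c, g c) - ⨅ c, g c) ^ 2 + P.φ₁ α κ * ((⨆ c, g c) - ⨅ c, g c)

/-- The function `s`. -/
def sFun (P : PMRound A A' B X Y C I S) (α : ℝ) (κ : ℕ) (x : ℝ) : ℝ :=
  if P.φ₁ α κ ≤ x then (x - P.φ₁ α κ) ^ 2 / (4 * P.φ₀ α) else 0

/-- The function `T̂*`, with value `+∞` off the hyperplane `∑ c, lam c = 0`. -/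
def ThatConj (P : PMRound A A' B X Y C I S) (α : ℝ) (κ : ℕ) (lam : C → ℝ) : EReal :=
  if ∑ c, lam c = 0 then (P.sFun α κ ((∑ c, |lam c|) / 2) : EReal) else ⊤

/-- `r_best`: the supremum of `g(q_hon) - T̂(g)` over all crossover min-tradeoff functions. -/
def rBest (P : PMRound A A' B X Y C I S) (α : ℝ) (κ : ℕ) (qhon : C → ℝ) : EReal :=
  ⨆ (g : C → ℝ) (k : ℝ) (_ : P.IsCrossoverMinTradeoff g k),
    ((g ⬝ᵥ qhon + k - P.That α κ g : ℝ) : EReal)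

/-! ### The linearized problem and its dual -/

/-- `L` is an affine function of `(ρ, μ)` that is a lower bound on
`W(ρ^g_J) + s(∑ μ_c / 2)` for Choi matrices `J` and vectors `μ ≥ 0`. -/
def IsAffineLowerBound (P : PMRound A A' B X Y C I S) (α : ℝ) (κ : ℕ)
    (L : (Matrix (A × B) (A × B) ℂ × (C → ℝ)) →ᵃ[ℝ] ℝ) : Prop :=
  ∀ (J : Matrix (A' × B) (A' × B) ℂ) (μ : C → ℝ), IsChoi J → 0 ≤ μ →
    L (P.ρg J, μ) ≤ P.W (P.ρg J) + P.sFun α κ ((∑ c, μ c) / 2)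

/-- `r_SDP`: the value of the semidefinite program with the affine objective `L`. -/
def rSDP (P : PMRound A A' B X Y C I S)
    (L : (Matrix (A × B) (A × B) ℂ × (C → ℝ)) →ᵃ[ℝ] ℝ) (qhon : C → ℝ) : EReal :=
  ⨅ (J : Matrix (A' × B) (A' × B) ℂ) (lam : C → ℝ) (μ : C → ℝ) (_ : IsChoi J)
    (_ : qhon - P.Φ (P.ρt J) - lam = 0) (_ : -μ ≤ lam ∧ lam ≤ μ), (L (P.ρg J, μ) : EReal)

/-- The Lagrange dual function of the semidefinite program for the multiplier `g` of the constraint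
`qhon - Φ[ρ^t_J] - lam = 0`, with Lagrangian `L(ρ^g_J, μ) + g ⬝ (qhon - Φ[ρ^t_J] - lam)`. -/
def dualSDP (P : PMRound A A' B X Y C I S)
    (L : (Matrix (A × B) (A × B) ℂ × (C → ℝ)) →ᵃ[ℝ] ℝ) (qhon : C → ℝ) (g : C → ℝ) : EReal :=
  ⨅ (J : Matrix (A' × B) (A' × B) ℂ) (lam : C → ℝ) (μ : C → ℝ) (_ : IsChoi J)
    (_ : -μ ≤ lam ∧ lam ≤ μ),
    ((L (P.ρg J, μ) + g ⬝ᵥ (qhon - P.Φ (P.ρt J) - lam) : ℝ) : EReal)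

/-- `g` is an optimal dual solution: it maximizes the dual function. -/
def IsOptimalDual (P : PMRound A A' B X Y C I S)
    (L : (Matrix (A × B) (A × B) ℂ × (C → ℝ)) →ᵃ[ℝ] ℝ) (qhon : C → ℝ) (g : C → ℝ) : Prop :=
  ∀ g' : C → ℝ, P.dualSDP L qhon g' ≤ P.dualSDP L qhon g

end PMRound

end

/-!
Conjugate duality for the rate `r_best` of a prepare-and-measure round.

A crossover min-tradeoff function is an affine function `g ⬝ q + k` with `g ⬝ Φ[ρ^t_J] + k` at most
`W(ρ^g_J)` for all Choi matrices `J` (`PMRound.isCrossoverMinTradeoff_iff`). Hence `r_best` is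
the supremum over `g` of the infimum, over `J` and over `lam` with `∑ c, lam c = 0`, of the Lagrangian
`W(ρ^g_J) + s(‖lam‖₁ / 2) + g ⬝ (qhon - Φ[ρ^t_J] - lam)`: minimizing over `lam` yields the term
`-T̂(g)`, because `R ↦ φ₀ R ^ 2 + φ₁ R` and `s` are conjugate to each other and
`g ⬝ lam ≤ (max g - min g) ‖lam‖₁ / 2` on the hyperplane `∑ c, lam c = 0`, with equality for multiples
of a difference of two unit vectors (`PMRound.dotProduct_le_That_add_sFun`,
`PMRound.exists_dotProduct_eq_That_add_sFun`). Both programs for `r_best` follow from strong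
duality, `exists_multiplier_of_le_add`. It is a separation argument that needs neither compactness
nor a Slater point, because the penalty `s(‖lam‖₁ / 2)` is finite and continuous on all of `ℝ^C`. The
constraint `∑ c, lam c = 0` can be dropped there, since it holds for `lam = qhon - Φ[ρ^t_J]`, a
difference of probability distributions.

The analytic input is the convexity of `J ↦ W(ρ^g_J)` (`PMRound.convexOn_W_ρg`). The states of the
purifying system have the same nonzero spectra as states on `AB`, so that `H(S|IE)` is the entropy
gained when a state that is linear in `ρ` is pinched (`cqCondEntropy_eq_relEntropy`). That gain is the
relative entropy `D(Z‖pinching Z)`, and the relative entropy is jointly convex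
(`relEntropy_combo_le`). To see the latter, consider the quadratic forms
`⟨ρ, (L_σ + t R_ρ)⁻¹ ρ⟩`, where `L` and `R` are left and right multiplication. Each of them is jointly
convex, being a supremum of functionals that are linear in `(ρ, σ)`, and up to a linear term their
integral over `t ∈ [0, ∞)` is `D(ρ‖σ)`.

For the linearized program, a finite value forces the affine bound `L` to be nondecreasing in each
`μ c`; the optimal `μ` is then `|lam|`, and the same duality theorem applies
(`PMRound.exists_le_dualSDP`). Since `L` lies below `W + s`, a lower bound on the Lagrangian of the
linearized program is one on the Lagrangian above, which turns every dual optimum into a crossover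
min-tradeoff function. If the value is `-∞`, every multiplier is optimal, and a suitable constant
exists because `L`, hence `W`, is bounded below on the set of Choi matrices.
-/

noncomputable section

/-! ### Joint convexity of the relative entropy -/

section RelativeEntropy

open Matrix Filter Topology

variable {n : Type*} [Fintype n] [DecidableEq n]

lemma trace_diagonal_sandwich {m n : Type*} [Fintype m] [Fintype n] [DecidableEq m] [DecidableEq n]
    (Y : Matrix m n ℂ) (f : n → ℝ) (h : m → ℝ) :
    (Y * diagonal (fun i => (f i : ℂ)) * Yᴴ * diagonal (fun j => (h j : ℂ))).trace =
      ((∑ i, ∑ j, ‖Y j i‖ ^ 2 * (f i * h j) : ℝ) : ℂ) := by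
  rw [Finset.sum_comm]
  simp only [trace, diag_apply, mul_diagonal]
  push_cast
  refine Finset.sum_congr rfl fun j _ => ?_
  rw [Matrix.mul_apply, Finset.sum_mul]
  refine Finset.sum_congr rfl fun i _ => ?_
  have := Complex.mul_conj' (Y j i)
  rw [mul_diagonal, conjTranspose_apply, RCLike.star_def, ← this]
  ring

/-- The matrix of inner products `⟨vⱼ, uᵢ⟩` of the eigenvectors `u` of `ρ` and `v` of `σ`. -/
def eigenOverlap {ρ σ : Matrix n n ℂ} (hρ : ρ.IsHermitian) (hσ : σ.IsHermitian) : Matrix n n ℂ :=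
  (hσ.eigenvectorUnitary : Matrix n n ℂ)ᴴ * (hρ.eigenvectorUnitary : Matrix n n ℂ)

lemma Matrix.IsHermitian.cfc_eq_mul {ρ : Matrix n n ℂ} (hρ : ρ.IsHermitian) (f : ℝ → ℝ) :
    cfc f ρ = (hρ.eigenvectorUnitary : Matrix n n ℂ) *
      diagonal (fun i => (f (hρ.eigenvalues i) : ℂ)) *
      (hρ.eigenvectorUnitary : Matrix n n ℂ)ᴴ := by
  rw [hρ.cfc_eq, Matrix.IsHermitian.cfc, Unitary.conjStarAlgAut_apply]
  rfl

lemma Matrix.IsHermitian.eq_mul {ρ : Matrix n n ℂ} (hρ : ρ.IsHermitian) :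
    ρ = (hρ.eigenvectorUnitary : Matrix n n ℂ) *
      diagonal (fun i => (hρ.eigenvalues i : ℂ)) *
      (hρ.eigenvectorUnitary : Matrix n n ℂ)ᴴ := by
  conv_lhs => rw [hρ.spectral_theorem, Unitary.conjStarAlgAut_apply]
  rfl

lemma Matrix.IsHermitian.eigenvectorUnitary_conjTranspose_mul {ρ : Matrix n n ℂ}
    (hρ : ρ.IsHermitian) :
    (hρ.eigenvectorUnitary : Matrix n n ℂ)ᴴ * (hρ.eigenvectorUnitary : Matrix n n ℂ) = 1 :=
  Unitary.coe_star_mul_self hρ.eigenvectorUnitary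

lemma trace_cfc_mul_cfc {ρ σ : Matrix n n ℂ} (hρ : ρ.IsHermitian) (hσ : σ.IsHermitian)
    (f h : ℝ → ℝ) :
    (cfc f ρ * cfc h σ).trace =
      ((∑ i, ∑ j, ‖eigenOverlap hρ hσ j i‖ ^ 2 *
        (f (hρ.eigenvalues i) * h (hσ.eigenvalues j)) : ℝ) : ℂ) := by
  rw [← trace_diagonal_sandwich (eigenOverlap hρ hσ), hρ.cfc_eq_mul, hσ.cfc_eq_mul, eigenOverlap]
  simp only [conjTranspose_mul, conjTranspose_conjTranspose, Matrix.mul_assoc]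
  rw [trace_mul_comm (hσ.eigenvectorUnitary : Matrix n n ℂ)ᴴ]
  simp only [Matrix.mul_assoc]

/-- For a fixed matrix `X`, a functional that is real linear in `(ρ, σ)`. The supremum over `X` is
`⟨ρ, (L_σ + s R_ρ)⁻¹ ρ⟩`, where `L` and `R` are left and right multiplication. -/
def resolventFunctional (s : ℝ) (X ρ σ : Matrix n n ℂ) : ℝ :=
  (2 * (Xᴴ * ρ).trace - (Xᴴ * σ * X).trace - s * (X * ρ * Xᴴ).trace).re

lemma resolventFunctional_combo {n : Type*} [Fintype n] (s : ℝ) (X ρ₀ ρ₁ σ₀ σ₁ : Matrix n n ℂ) (a b : ℝ) :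
    resolventFunctional s X (a • ρ₀ + b • ρ₁) (a • σ₀ + b • σ₁) =
      a * resolventFunctional s X ρ₀ σ₀ + b * resolventFunctional s X ρ₁ σ₁ := by
  simp only [resolventFunctional, Matrix.mul_add, Matrix.add_mul, trace_add, Matrix.mul_smul,
    Matrix.smul_mul, trace_smul, Complex.sub_re, Complex.add_re, Complex.mul_re, Complex.smul_re,
    Complex.smul_im, Complex.add_im, Complex.ofReal_re, Complex.ofReal_im, smul_eq_mul,
    Complex.re_ofNat, Complex.im_ofNat]
  ring

/-- The quadratic form `⟨ρ, (L_σ + s R_ρ)⁻¹ ρ⟩` in eigenbases of `ρ` and `σ`. -/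
def resolventForm {ρ σ : Matrix n n ℂ} (hρ : ρ.IsHermitian) (hσ : σ.IsHermitian) (s : ℝ) : ℝ :=
  ∑ i, ∑ j, ‖eigenOverlap hρ hσ j i‖ ^ 2 *
    (hρ.eigenvalues i ^ 2 / (hσ.eigenvalues j + s * hρ.eigenvalues i))

lemma resolventFunctional_eq_sum {ρ σ : Matrix n n ℂ} (hρ : ρ.IsHermitian) (hσ : σ.IsHermitian)
    (s : ℝ) (Y : Matrix n n ℂ) :
    resolventFunctional s ((hσ.eigenvectorUnitary : Matrix n n ℂ) * Y *
        (hρ.eigenvectorUnitary : Matrix n n ℂ)ᴴ) ρ σ =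
      ∑ i, ∑ j, (2 * (star (Y j i) * eigenOverlap hρ hσ j i).re * hρ.eigenvalues i
        - ‖Y j i‖ ^ 2 * (hσ.eigenvalues j + s * hρ.eigenvalues i)) := by
  set U := (hρ.eigenvectorUnitary : Matrix n n ℂ) with hU
  set V := (hσ.eigenvectorUnitary : Matrix n n ℂ) with hV
  have hUU : Uᴴ * U = 1 := hρ.eigenvectorUnitary_conjTranspose_mul
  have hVV : Vᴴ * V = 1 := hσ.eigenvectorUnitary_conjTranspose_mul
  have e1 : ((V * Y * Uᴴ)ᴴ * ρ).trace =
      (Yᴴ * (eigenOverlap hρ hσ * diagonal fun i => (hρ.eigenvalues i : ℂ))).trace := by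
    conv_lhs => rw [hρ.eq_mul]
    rw [eigenOverlap, ← hU, ← hV]
    simp only [conjTranspose_mul, conjTranspose_conjTranspose, Matrix.mul_assoc]
    rw [trace_mul_comm]
    simp only [Matrix.mul_assoc, hUU, Matrix.mul_one]
  have e2 : ((V * Y * Uᴴ)ᴴ * σ * (V * Y * Uᴴ)).trace =
      (Yᴴ * (diagonal fun i => (hσ.eigenvalues i : ℂ)) * Yᴴᴴ *
        diagonal fun _ => ((1 : ℝ) : ℂ)).trace := by
    conv_lhs => rw [hσ.eq_mul]
    rw [← hV]
    simp only [conjTranspose_mul, conjTranspose_conjTranspose, Matrix.mul_assoc]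
    rw [trace_mul_comm]
    simp only [Matrix.mul_assoc]
    rw [← Matrix.mul_assoc Vᴴ V, hVV, hUU, ← Matrix.mul_assoc Vᴴ V, hVV]
    simp
  have e3 : ((V * Y * Uᴴ) * ρ * (V * Y * Uᴴ)ᴴ).trace =
      (Y * (diagonal fun i => (hρ.eigenvalues i : ℂ)) * Yᴴ *
        diagonal fun _ => ((1 : ℝ) : ℂ)).trace := by
    conv_lhs => rw [hρ.eq_mul]
    rw [← hU]
    simp only [conjTranspose_mul, conjTranspose_conjTranspose, Matrix.mul_assoc]
    rw [trace_mul_comm]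
    simp only [Matrix.mul_assoc]
    rw [hVV, ← Matrix.mul_assoc Uᴴ U, hUU, ← Matrix.mul_assoc Uᴴ U, hUU]
    simp
  rw [resolventFunctional, e1, e2, e3, trace_diagonal_sandwich, trace_diagonal_sandwich]
  have e4 : (Yᴴ * (eigenOverlap hρ hσ * diagonal fun i => (hρ.eigenvalues i : ℂ))).trace.re =
      ∑ i, ∑ j, (star (Y j i) * eigenOverlap hρ hσ j i).re * hρ.eigenvalues i := by
    simp only [trace, diag_apply, Complex.re_sum]
    refine Finset.sum_congr rfl fun i _ => ?_
    rw [Matrix.mul_apply, Complex.re_sum]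
    refine Finset.sum_congr rfl fun j _ => ?_
    rw [mul_diagonal, conjTranspose_apply, ← mul_assoc, Complex.re_mul_ofReal]
  rw [← Complex.ofReal_mul, Complex.sub_re, Complex.sub_re, Complex.ofReal_re, Complex.ofReal_re,
    show (2 : ℂ) = ((2 : ℝ) : ℂ) by norm_num, Complex.re_ofReal_mul, e4]
  rw [Finset.sum_comm (f := fun i j => ‖Yᴴ j i‖ ^ 2 * _)]
  simp only [Finset.mul_sum, ← Finset.sum_sub_distrib, conjTranspose_apply, norm_star]
  refine Finset.sum_congr rfl fun i _ => Finset.sum_congr rfl fun j _ => ?_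
  ring

lemma two_re_mul_sub_le (y w : ℂ) (p : ℝ) {d : ℝ} (hd : 0 < d) :
    2 * (star y * w).re * p - ‖y‖ ^ 2 * d ≤ ‖w‖ ^ 2 * (p ^ 2 / d) := by
  -- complete the square
  have h1 : 0 ≤ ‖w * p - y * d‖ ^ 2 := sq_nonneg _
  rw [← Complex.normSq_eq_norm_sq] at *
  rw [← Complex.normSq_eq_norm_sq]
  simp only [Complex.normSq_apply, Complex.sub_re, Complex.sub_im, Complex.im_mul_ofReal,
    Complex.ofReal_re, Complex.ofReal_im,
    RCLike.star_def, Complex.mul_re, Complex.conj_re, Complex.conj_im] at *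
  rw [← mul_div_assoc, le_div_iff₀ hd]
  nlinarith

lemma resolventFunctional_le {ρ σ : Matrix n n ℂ} (hρ : ρ.PosSemidef) (hσ : σ.PosSemidef)
    {s : ℝ} (hs : 0 < s) (X : Matrix n n ℂ) :
    resolventFunctional s X ρ σ ≤ resolventForm hρ.1 hσ.1 s := by
  set U := (hρ.1.eigenvectorUnitary : Matrix n n ℂ) with hU
  set V := (hσ.1.eigenvectorUnitary : Matrix n n ℂ) with hV
  have hUU : U * Uᴴ = 1 := Unitary.coe_mul_star_self hρ.1.eigenvectorUnitary
  have hVV : V * Vᴴ = 1 := Unitary.coe_mul_star_self hσ.1.eigenvectorUnitary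
  have hX : X = V * (Vᴴ * X * U) * Uᴴ := by
    rw [← Matrix.mul_assoc, ← Matrix.mul_assoc, hVV, Matrix.mul_assoc, hUU]; simp
  rw [hX, resolventFunctional_eq_sum, resolventForm]
  refine Finset.sum_le_sum fun i _ => Finset.sum_le_sum fun j _ => ?_
  have hp := hρ.eigenvalues_nonneg i
  have hq := hσ.eigenvalues_nonneg j
  rcases hp.eq_or_lt with h | h
  · rw [← h]; simp; positivity
  · exact two_re_mul_sub_le _ _ _ (by positivity)

lemma exists_resolventFunctional_eq {ρ σ : Matrix n n ℂ} (hρ : ρ.PosSemidef) (hσ : σ.PosSemidef)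
    {s : ℝ} (hs : 0 < s) :
    ∃ X, resolventFunctional s X ρ σ = resolventForm hρ.1 hσ.1 s := by
  refine ⟨_, (resolventFunctional_eq_sum hρ.1 hσ.1 s (Matrix.of fun j i =>
    eigenOverlap hρ.1 hσ.1 j i * ((hρ.1.eigenvalues i /
      (hσ.1.eigenvalues j + s * hρ.1.eigenvalues i) : ℝ) : ℂ))).trans ?_⟩
  refine Finset.sum_congr rfl fun i _ => Finset.sum_congr rfl fun j _ => ?_
  have hp := hρ.eigenvalues_nonneg i
  have hq := hσ.eigenvalues_nonneg j
  set p := hρ.1.eigenvalues i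
  set q := hσ.1.eigenvalues j
  set w := eigenOverlap hρ.1 hσ.1 j i
  rcases hp.eq_or_lt with h | h
  · have h0 : hρ.1.eigenvalues i = 0 := h.symm
    simp [← h, h0]
  · have hd : 0 < q + s * p := by positivity
    have hY : (Matrix.of fun j i => eigenOverlap hρ.1 hσ.1 j i * ((hρ.1.eigenvalues i /
      (hσ.1.eigenvalues j + s * hρ.1.eigenvalues i) : ℝ) : ℂ)) j i =
        w * ((p / (q + s * p) : ℝ) : ℂ) := rfl
    rw [hY]
    simp only [star_mul', norm_mul, Complex.norm_real, RCLike.star_def,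
      Complex.conj_ofReal, Real.norm_eq_abs, mul_pow, sq_abs]
    rw [mul_right_comm ((starRingEnd ℂ) w), Complex.re_mul_ofReal, mul_comm _ w,
      Complex.mul_conj, Complex.normSq_eq_norm_sq, Complex.ofReal_re]
    field_simp
    ring

/-- As a supremum of linear functionals of `(ρ, σ)`, the quadratic form `⟨ρ, (L_σ + s R_ρ)⁻¹ ρ⟩` is
jointly convex. -/
lemma resolventForm_combo_le {ρ₀ ρ₁ σ₀ σ₁ : Matrix n n ℂ} (hρ₀ : ρ₀.PosSemidef)
    (hρ₁ : ρ₁.PosSemidef) (hσ₀ : σ₀.PosSemidef) (hσ₁ : σ₁.PosSemidef) {a b : ℝ} (ha : 0 ≤ a)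
    (hb : 0 ≤ b) (hρ : (a • ρ₀ + b • ρ₁).PosSemidef) (hσ : (a • σ₀ + b • σ₁).PosSemidef)
    {s : ℝ} (hs : 0 < s) :
    resolventForm hρ.1 hσ.1 s ≤
      a * resolventForm hρ₀.1 hσ₀.1 s + b * resolventForm hρ₁.1 hσ₁.1 s := by
  obtain ⟨X, hX⟩ := exists_resolventFunctional_eq hρ hσ hs
  rw [← hX, resolventFunctional_combo]
  exact add_le_add (mul_le_mul_of_nonneg_left (resolventFunctional_le hρ₀ hσ₀ hs X) ha)
    (mul_le_mul_of_nonneg_left (resolventFunctional_le hρ₁ hσ₁ hs X) hb)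

/-- An antiderivative of `resolventForm`; at `0` it is `tr ρ log σ`, and up to `(tr ρ) log t` it
tends to `tr ρ log ρ` as `t → ∞`. -/
def logForm {ρ σ : Matrix n n ℂ} (hρ : ρ.IsHermitian) (hσ : σ.IsHermitian) (t : ℝ) : ℝ :=
  ∑ i, ∑ j, ‖eigenOverlap hρ hσ j i‖ ^ 2 *
    (hρ.eigenvalues i * Real.log (hσ.eigenvalues j + t * hρ.eigenvalues i))

lemma hasDerivAt_logForm {ρ σ : Matrix n n ℂ} (hρ : ρ.PosSemidef) (hσ : σ.PosSemidef)
    {t : ℝ} (ht : 0 < t) :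
    HasDerivAt (logForm hρ.1 hσ.1) (resolventForm hρ.1 hσ.1 t) t := by
  unfold logForm resolventForm
  refine HasDerivAt.fun_sum fun i _ => HasDerivAt.fun_sum fun j _ => ?_
  have hp := hρ.eigenvalues_nonneg i
  have hq := hσ.eigenvalues_nonneg j
  refine HasDerivAt.const_mul _ ?_
  rcases hp.eq_or_lt with h | h
  · simpa [← h] using hasDerivAt_const t (0 : ℝ)
  · have hd : 0 < hσ.1.eigenvalues j + t * hρ.1.eigenvalues i := by positivity
    have h1 : HasDerivAt (fun t => hσ.1.eigenvalues j + t * hρ.1.eigenvalues i)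
        (hρ.1.eigenvalues i) t := by
      simpa using ((hasDerivAt_id t).mul_const (hρ.1.eigenvalues i)).const_add
        (hσ.1.eigenvalues j)
    convert (h1.log hd.ne').const_mul (hρ.1.eigenvalues i) using 1
    ring

/-- When the kernel of `σ` lies in that of `ρ`, eigenvectors of `σ` for the eigenvalue `0` are
orthogonal to those of `ρ` for nonzero eigenvalues. -/
lemma eigenOverlap_mul_eigenvalues_eq_zero {ρ σ : Matrix n n ℂ} (hρ : ρ.IsHermitian)
    (hσ : σ.IsHermitian) (hker : ∀ v, σ *ᵥ v = 0 → ρ *ᵥ v = 0) {i j : n}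
    (hj : hσ.eigenvalues j = 0) : ‖eigenOverlap hρ hσ j i‖ ^ 2 * hρ.eigenvalues i = 0 := by
  set U := (hρ.eigenvectorUnitary : Matrix n n ℂ) with hU
  set V := (hσ.eigenvectorUnitary : Matrix n n ℂ) with hV
  have hUU : Uᴴ * U = 1 := hρ.eigenvectorUnitary_conjTranspose_mul
  have h1 : σ *ᵥ (V *ᵥ Pi.single j 1) = 0 := by
    have h2 : σ * V = V * diagonal fun i => (hσ.eigenvalues i : ℂ) := by
      conv_lhs => rw [hσ.eq_mul]
      rw [Matrix.mul_assoc, ← hV, hσ.eigenvectorUnitary_conjTranspose_mul, Matrix.mul_one]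
    rw [mulVec_mulVec, h2, ← mulVec_mulVec]
    have : (diagonal fun i => (hσ.eigenvalues i : ℂ)) *ᵥ (Pi.single j 1 : n → ℂ) = 0 := by
      ext k
      rw [mulVec_diagonal, Pi.single_apply]
      split_ifs with h
      · simp [h, hj]
      · simp
    rw [this, mulVec_zero]
  have h3 := hker _ h1
  have h4 : (Uᴴ * ρ * V) *ᵥ Pi.single j 1 = 0 := by
    rw [← mulVec_mulVec, ← mulVec_mulVec, h3, mulVec_zero]
  have h5 : Uᴴ * ρ * V = (diagonal fun i => (hρ.eigenvalues i : ℂ)) * (eigenOverlap hρ hσ)ᴴ := by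
    conv_lhs => rw [hρ.eq_mul]
    rw [eigenOverlap, ← hU, ← hV, conjTranspose_mul, conjTranspose_conjTranspose,
      Matrix.mul_assoc U, ← Matrix.mul_assoc Uᴴ U, hUU, Matrix.one_mul, Matrix.mul_assoc]
  have h6 := congrFun h4 i
  rw [h5] at h6
  simp only [mulVec_single_one, col_apply, diagonal_mul, conjTranspose_apply, Pi.zero_apply,
    mul_eq_zero, star_eq_zero, Complex.ofReal_eq_zero] at h6
  rcases h6 with h | h
  · simp [h]
  · simp [h]

lemma continuousOn_logForm {ρ σ : Matrix n n ℂ} (hρ : ρ.PosSemidef) (hσ : σ.PosSemidef)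
    (hker : ∀ v, σ *ᵥ v = 0 → ρ *ᵥ v = 0) :
    ContinuousOn (logForm hρ.1 hσ.1) (Set.Ici 0) := by
  unfold logForm
  refine continuousOn_finsetSum _ fun i _ => continuousOn_finsetSum _ fun j _ => ?_
  have hp := hρ.eigenvalues_nonneg i
  have hq := hσ.eigenvalues_nonneg j
  rcases hq.eq_or_lt with h | h
  · have h0 := eigenOverlap_mul_eigenvalues_eq_zero hρ.1 hσ.1 hker (i := i) h.symm
    simp only [← mul_assoc, h0, zero_mul]
    exact continuousOn_const
  · refine continuousOn_const.mul (continuousOn_const.mul (ContinuousOn.log (by fun_prop) ?_))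
    intro t ht
    have ht : 0 ≤ t := ht
    positivity

/-- The trace of `ρ`, written in eigenbases. -/
lemma trace_eq_sum_eigenOverlap {ρ σ : Matrix n n ℂ} (hρ : ρ.IsHermitian) (hσ : σ.IsHermitian) :
    ρ.trace.re = ∑ i, ∑ j, ‖eigenOverlap hρ hσ j i‖ ^ 2 * hρ.eigenvalues i := by
  have h := trace_cfc_mul_cfc hρ hσ id (fun _ => 1)
  have h1 : cfc id ρ = ρ := cfc_id ℝ ρ hρ
  have h2 : cfc (fun _ : ℝ => (1 : ℝ)) σ = 1 := cfc_const_one ℝ σ hσ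
  rw [h1, h2, Matrix.mul_one] at h
  rw [h, Complex.ofReal_re]
  simp

/-- `tr ρ log ρ - tr ρ log σ`, the relative entropy of positive semidefinite matrices with
`ker σ ≤ ker ρ`, in nats. -/
def relEntropy (ρ σ : Matrix n n ℂ) : ℝ :=
  (cfc (fun x => x * Real.log x) ρ).trace.re - (ρ * cfc Real.log σ).trace.re

lemma trace_mul_cfc_log_eq_logForm {ρ σ : Matrix n n ℂ} (hρ : ρ.IsHermitian)
    (hσ : σ.IsHermitian) : (ρ * cfc Real.log σ).trace.re = logForm hρ hσ 0 := by
  have h := trace_cfc_mul_cfc hρ hσ id Real.log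
  have h1 : cfc id ρ = ρ := cfc_id ℝ ρ hρ
  rw [h1] at h
  rw [h, Complex.ofReal_re]
  simp [logForm]

lemma tendsto_logForm {ρ σ : Matrix n n ℂ} (hρ : ρ.PosSemidef) (hσ : σ.PosSemidef) :
    Tendsto (fun t => logForm hρ.1 hσ.1 t - ρ.trace.re * Real.log t) atTop
      (𝓝 (cfc (fun x => x * Real.log x) ρ).trace.re) := by
  have h := trace_cfc_mul_cfc hρ.1 hσ.1 (fun x => x * Real.log x) (fun _ => 1)
  have h2 : cfc (fun _ : ℝ => (1 : ℝ)) σ = 1 := cfc_const_one ℝ σ hσ.1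
  rw [h2, Matrix.mul_one] at h
  rw [h, Complex.ofReal_re, trace_eq_sum_eigenOverlap hρ.1 hσ.1]
  simp only [logForm, Finset.sum_mul, ← Finset.sum_sub_distrib]
  refine tendsto_finsetSum _ fun i _ => tendsto_finsetSum _ fun j _ => ?_
  have hp := hρ.eigenvalues_nonneg i
  have hq := hσ.eigenvalues_nonneg j
  set p := hρ.1.eigenvalues i
  set q := hσ.1.eigenvalues j
  set w := eigenOverlap hρ.1 hσ.1 j i
  rcases hp.eq_or_lt with h | h
  · simp [← h]
  · have h1 : Tendsto (fun t : ℝ => Real.log (q / t + p)) atTop (𝓝 (Real.log (0 + p))) := by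
      refine Tendsto.log ?_ (by simpa using h.ne')
      exact (tendsto_const_nhds.div_atTop tendsto_id).add tendsto_const_nhds
    rw [zero_add] at h1
    have h2 := (h1.const_mul p).const_mul (‖w‖ ^ 2)
    rw [mul_one]
    refine h2.congr' ?_
    filter_upwards [eventually_gt_atTop 0] with t ht
    have : q / t + p = (q + t * p) / t := by field_simp
    rw [this, Real.log_div (by positivity) ht.ne']
    ring

/-- **Joint convexity of the relative entropy**. The difference of the two sides is the increase
over `[0, ∞)` of a combination of `logForm`s, whose derivative is nonnegative by the joint convexity
of `resolventForm`. -/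
theorem relEntropy_combo_le {ρ₀ ρ₁ σ₀ σ₁ : Matrix n n ℂ} (hρ₀ : ρ₀.PosSemidef)
    (hρ₁ : ρ₁.PosSemidef) (hσ₀ : σ₀.PosSemidef) (hσ₁ : σ₁.PosSemidef) {a b : ℝ} (ha : 0 ≤ a)
    (hb : 0 ≤ b) (hρ : (a • ρ₀ + b • ρ₁).PosSemidef) (hσ : (a • σ₀ + b • σ₁).PosSemidef)
    (hk₀ : ∀ v, σ₀ *ᵥ v = 0 → ρ₀ *ᵥ v = 0) (hk₁ : ∀ v, σ₁ *ᵥ v = 0 → ρ₁ *ᵥ v = 0)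
    (hk : ∀ v, (a • σ₀ + b • σ₁) *ᵥ v = 0 → (a • ρ₀ + b • ρ₁) *ᵥ v = 0) :
    relEntropy (a • ρ₀ + b • ρ₁) (a • σ₀ + b • σ₁) ≤
      a * relEntropy ρ₀ σ₀ + b * relEntropy ρ₁ σ₁ := by
  set K : ℝ → ℝ := fun t => a * logForm hρ₀.1 hσ₀.1 t + b * logForm hρ₁.1 hσ₁.1 t
    - logForm hρ.1 hσ.1 t with hK
  have hmono : MonotoneOn K (Set.Ici 0) := by
    have hd : ∀ t : ℝ, 0 < t → HasDerivAt K (a * resolventForm hρ₀.1 hσ₀.1 t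
        + b * resolventForm hρ₁.1 hσ₁.1 t - resolventForm hρ.1 hσ.1 t) t := fun t ht =>
      (((hasDerivAt_logForm hρ₀ hσ₀ ht).const_mul a).add
        ((hasDerivAt_logForm hρ₁ hσ₁ ht).const_mul b)).sub (hasDerivAt_logForm hρ hσ ht)
    refine monotoneOn_of_deriv_nonneg (convex_Ici 0) ?_ ?_ ?_
    · exact ((continuousOn_const.mul (continuousOn_logForm hρ₀ hσ₀ hk₀)).add
        (continuousOn_const.mul (continuousOn_logForm hρ₁ hσ₁ hk₁))).sub
        (continuousOn_logForm hρ hσ hk)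
    · intro t ht
      rw [interior_Ici] at ht
      exact (hd t ht).differentiableAt.differentiableWithinAt
    · intro t ht
      rw [interior_Ici] at ht
      rw [(hd t ht).deriv]
      linarith [resolventForm_combo_le hρ₀ hρ₁ hσ₀ hσ₁ ha hb hρ hσ ht]
  have htr : (a • ρ₀ + b • ρ₁).trace.re = a * ρ₀.trace.re + b * ρ₁.trace.re := by
    simp [trace_add, trace_smul]
  have hlim := ((((tendsto_logForm hρ₀ hσ₀).const_mul a).add
    ((tendsto_logForm hρ₁ hσ₁).const_mul b)).sub (tendsto_logForm hρ hσ))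
  have h0 : K 0 ≤ _ := ge_of_tendsto hlim (by
    filter_upwards [eventually_ge_atTop 0] with t ht
    refine (hmono (Set.mem_Ici.2 le_rfl) ht ht).trans (le_of_eq ?_)
    rw [htr]
    simp only [hK]
    ring)
  simp only [hK, ← trace_mul_cfc_log_eq_logForm] at h0
  unfold relEntropy
  linarith

end RelativeEntropy

/-! ### Entropies as functions of the characteristic polynomial -/

section Entropy

open Matrix Polynomial

variable {m n : Type*} [Fintype m] [DecidableEq m] [Fintype n] [DecidableEq n]

lemma Matrix.IsHermitian.trace_cfc_eq_sum_roots {A : Matrix n n ℂ} (hA : A.IsHermitian)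
    (f : ℝ → ℝ) :
    (cfc f A).trace = (A.charpoly.roots.map fun z => ((f z.re : ℝ) : ℂ)).sum := by
  rw [hA.roots_charpoly_eq_eigenvalues, hA.cfc_eq_mul, trace_mul_comm, ← Matrix.mul_assoc,
    hA.eigenvectorUnitary_conjTranspose_mul, Matrix.one_mul, trace_diagonal, Multiset.map_map]
  simp

lemma vnEntropy_eq_of_charpoly_eq {A : Matrix m m ℂ} {B : Matrix n n ℂ} (hA : A.IsHermitian)
    (hB : B.IsHermitian) (h : A.charpoly = B.charpoly) : vnEntropy A = vnEntropy B := by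
  rw [vnEntropy, vnEntropy, hA.trace_cfc_eq_sum_roots, hB.trace_cfc_eq_sum_roots, h]

lemma vnEntropy_transpose {A : Matrix n n ℂ} (hA : A.IsHermitian) :
    vnEntropy Aᵀ = vnEntropy A :=
  vnEntropy_eq_of_charpoly_eq hA.transpose hA (charpoly_transpose A)

lemma vnEntropy_reindex (e : m ≃ n) {A : Matrix m m ℂ} (hA : A.IsHermitian) :
    vnEntropy (A.reindex e e) = vnEntropy A :=
  vnEntropy_eq_of_charpoly_eq (hA.submatrix _) hA (charpoly_reindex e A)

/-- `XᴴX` and `XXᴴ` have the same nonzero eigenvalues, hence the same entropy. -/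
lemma vnEntropy_conjTranspose_mul_self (X : Matrix m n ℂ) :
    vnEntropy (Xᴴ * X) = vnEntropy (X * Xᴴ) := by
  have h := congrArg Polynomial.roots (charpoly_mul_comm' Xᴴ X)
  rw [roots_mul (mul_ne_zero (pow_ne_zero _ X_ne_zero) (charpoly_monic _).ne_zero),
    roots_mul (mul_ne_zero (pow_ne_zero _ X_ne_zero) (charpoly_monic _).ne_zero)] at h
  have h2 := congrArg (fun r : Multiset ℂ =>
    (r.map fun z => ((Real.negMulLog z.re : ℝ) : ℂ)).sum) h
  simp only [Multiset.map_add, Multiset.sum_add, roots_X_pow, Multiset.map_nsmul,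
    Multiset.sum_nsmul, Multiset.map_singleton, Multiset.sum_singleton, Complex.zero_re,
    Real.negMulLog_zero, Complex.ofReal_zero, smul_zero, zero_add] at h2
  rw [vnEntropy, vnEntropy, (isHermitian_conjTranspose_mul_self X).trace_cfc_eq_sum_roots,
    (isHermitian_mul_conjTranspose_self X).trace_cfc_eq_sum_roots, h2]

lemma vnEntropy_eq_neg (A : Matrix n n ℂ) :
    vnEntropy A = -(cfc (fun x => x * Real.log x) A).trace.re / Real.log 2 := by
  have h : Real.negMulLog = fun x => -(x * Real.log x) := by
    funext x; simp [Real.negMulLog]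
  have h1 : cfc (fun x => -(x * Real.log x)) A = -cfc (fun x => x * Real.log x) A := cfc_neg _ _
  rw [vnEntropy, h, h1, trace_neg, Complex.neg_re]

end Entropy

/-! ### Pinching -/

section Pinching

open Matrix

variable {m S : Type*} [DecidableEq m] [DecidableEq S]

/-- The projection onto the span of the basis vectors `p` with label `ℓ p = s`. -/
def labelProj (ℓ : m → S) (s : S) : Matrix m m ℂ :=
  diagonal fun p => if ℓ p = s then 1 else 0

lemma labelProj_conjTranspose (ℓ : m → S) (s : S) : (labelProj ℓ s)ᴴ = labelProj ℓ s := by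
  rw [labelProj, diagonal_conjTranspose]
  congr 1
  ext p
  simp [Pi.star_apply, apply_ite]

lemma labelProj_mul_labelProj [Fintype m] (ℓ : m → S) (s t : S) :
    labelProj ℓ s * labelProj ℓ t = if s = t then labelProj ℓ s else 0 := by
  rw [labelProj, labelProj, diagonal_mul_diagonal]
  split_ifs with h
  · subst h
    congr 1
    ext p
    simp
  · rw [← diagonal_zero]
    congr 1
    ext p
    by_cases h1 : ℓ p = s
    · simp [h1, h]
    · simp [h1]

lemma sum_labelProj [Fintype S] (ℓ : m → S) : ∑ s, labelProj ℓ s = 1 := by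
  ext p q
  rw [Matrix.sum_apply]
  simp only [labelProj, diagonal_apply, one_apply]
  split_ifs <;> simp

variable [Fintype m] [Fintype S]

/-- The matrix `Z` with the entries between basis vectors of different labels set to `0`. -/
def pinching (ℓ : m → S) (Z : Matrix m m ℂ) : Matrix m m ℂ :=
  ∑ s, labelProj ℓ s * Z * labelProj ℓ s

lemma pinching_apply (ℓ : m → S) (Z : Matrix m m ℂ) (p q : m) :
    pinching ℓ Z p q = if ℓ p = ℓ q then Z p q else 0 := by
  simp only [pinching, Matrix.sum_apply, labelProj, mul_diagonal, diagonal_mul]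
  rw [Finset.sum_eq_single (ℓ p) (fun s _ hs => by simp [hs.symm]) (by simp)]
  simp [eq_comm]

lemma pinching_combo (ℓ : m → S) (Z₀ Z₁ : Matrix m m ℂ) (a b : ℝ) :
    pinching ℓ (a • Z₀ + b • Z₁) = a • pinching ℓ Z₀ + b • pinching ℓ Z₁ := by
  ext p q
  simp only [pinching_apply, Matrix.add_apply, Matrix.smul_apply]
  split_ifs <;> simp

lemma Matrix.PosSemidef.pinching {Z : Matrix m m ℂ} (hZ : Z.PosSemidef) (ℓ : m → S) :
    (pinching ℓ Z).PosSemidef :=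
  posSemidef_sum _ fun s _ => by
    have := hZ.mul_mul_conjTranspose_same (labelProj ℓ s)
    rwa [labelProj_conjTranspose] at this

lemma pinching_commute_labelProj (ℓ : m → S) (Z : Matrix m m ℂ) (t : S) :
    Commute (pinching ℓ Z) (labelProj ℓ t) := by
  rw [commute_iff_eq, _root_.pinching, Finset.sum_mul, Finset.mul_sum]
  simp only [Matrix.mul_assoc, labelProj_mul_labelProj]
  simp only [← Matrix.mul_assoc, labelProj_mul_labelProj, mul_ite, ite_mul, mul_zero, zero_mul]
  rw [Finset.sum_ite_eq_of_mem' _ _ _ (Finset.mem_univ t),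
    Finset.sum_ite_eq_of_mem _ _ _ (Finset.mem_univ t)]

lemma mulVec_eq_zero_of_pinching_mulVec_eq_zero {Z : Matrix m m ℂ} (hZ : Z.PosSemidef)
    (ℓ : m → S) (v : m → ℂ) (hv : pinching ℓ Z *ᵥ v = 0) : Z *ᵥ v = 0 := by
  have h1 : ∑ s, star (labelProj ℓ s *ᵥ v) ⬝ᵥ (Z *ᵥ (labelProj ℓ s *ᵥ v)) = 0 := by
    have h2 : star v ⬝ᵥ (pinching ℓ Z *ᵥ v) = 0 := by rw [hv, dotProduct_zero]
    rw [_root_.pinching, sum_mulVec, dotProduct_sum] at h2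
    rw [← h2]
    refine Finset.sum_congr rfl fun s _ => ?_
    rw [star_mulVec, labelProj_conjTranspose, ← dotProduct_mulVec, mulVec_mulVec, mulVec_mulVec,
      Matrix.mul_assoc]
  rw [Finset.sum_eq_zero_iff_of_nonneg fun s _ => hZ.dotProduct_mulVec_nonneg _] at h1
  have h3 : ∀ s, Z *ᵥ (labelProj ℓ s *ᵥ v) = 0 := fun s =>
    (hZ.dotProduct_mulVec_zero_iff _).1 (h1 s (Finset.mem_univ s))
  calc Z *ᵥ v = Z *ᵥ ((∑ s, labelProj ℓ s) *ᵥ v) := by rw [sum_labelProj, one_mulVec]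
    _ = ∑ s, Z *ᵥ (labelProj ℓ s *ᵥ v) := by rw [sum_mulVec, mulVec_sum]
    _ = 0 := Finset.sum_eq_zero fun s _ => h3 s

/-- The entropy gained by pinching is the relative entropy with respect to the pinched matrix,
since the logarithm of the latter commutes with the projections of the pinching. -/
lemma relEntropy_pinching {Z : Matrix m m ℂ} (hZ : Z.PosSemidef) (ℓ : m → S) :
    relEntropy Z (pinching ℓ Z) / Real.log 2 = vnEntropy (pinching ℓ Z) - vnEntropy Z := by
  have hR := hZ.pinching ℓ
  have h1 : (Z * cfc Real.log (pinching ℓ Z)).trace =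
      (pinching ℓ Z * cfc Real.log (pinching ℓ Z)).trace := by
    set M := cfc Real.log (pinching ℓ Z) with hM
    have hc : ∀ s, M * labelProj ℓ s = labelProj ℓ s * M := fun s =>
      (pinching_commute_labelProj ℓ Z s).cfc_real Real.log
    symm
    calc (pinching ℓ Z * M).trace
        = ∑ s, (labelProj ℓ s * Z * labelProj ℓ s * M).trace := by
          rw [_root_.pinching, Finset.sum_mul, trace_sum]
      _ = ∑ s, (Z * (labelProj ℓ s * M)).trace := by
          refine Finset.sum_congr rfl fun s _ => ?_
          rw [Matrix.mul_assoc, Matrix.mul_assoc, trace_mul_comm, Matrix.mul_assoc,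
            Matrix.mul_assoc, hc, ← Matrix.mul_assoc (labelProj ℓ s), labelProj_mul_labelProj,
            if_pos rfl]
      _ = (Z * M).trace := by
          rw [← trace_sum, ← Finset.mul_sum, ← Finset.sum_mul, sum_labelProj, Matrix.one_mul]
  have h2 : pinching ℓ Z * cfc Real.log (pinching ℓ Z) =
      cfc (fun x => x * Real.log x) (pinching ℓ Z) := by
    have h3 : cfc (fun x : ℝ => id x * Real.log x) (pinching ℓ Z) =
        cfc (id : ℝ → ℝ) (pinching ℓ Z) * cfc Real.log (pinching ℓ Z) :=
      cfc_mul id Real.log _ (finite_real_spectrum.continuousOn _)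
        (finite_real_spectrum.continuousOn _)
    have h4 : cfc (id : ℝ → ℝ) (pinching ℓ Z) = pinching ℓ Z := cfc_id ℝ _ hR.1
    rw [h4] at h3
    exact h3.symm
  rw [relEntropy, h1, h2, vnEntropy_eq_neg, vnEntropy_eq_neg]
  ring

/-- The entropy gained by pinching is a convex function of the state. -/
theorem relEntropy_pinching_combo_le (ℓ : m → S) {Z₀ Z₁ : Matrix m m ℂ} (h₀ : Z₀.PosSemidef)
    (h₁ : Z₁.PosSemidef) {a b : ℝ} (ha : 0 ≤ a) (hb : 0 ≤ b) :
    relEntropy (a • Z₀ + b • Z₁) (pinching ℓ (a • Z₀ + b • Z₁)) ≤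
      a * relEntropy Z₀ (pinching ℓ Z₀) + b * relEntropy Z₁ (pinching ℓ Z₁) := by
  have h : (a • Z₀ + b • Z₁).PosSemidef := (h₀.smul ha).add (h₁.smul hb)
  have hp := h.pinching ℓ
  have hk := mulVec_eq_zero_of_pinching_mulVec_eq_zero h ℓ
  rw [pinching_combo] at hp hk ⊢
  exact relEntropy_combo_le h₀ h₁ (h₀.pinching ℓ) (h₁.pinching ℓ) ha hb h hp
    (mulVec_eq_zero_of_pinching_mulVec_eq_zero h₀ ℓ)
    (mulVec_eq_zero_of_pinching_mulVec_eq_zero h₁ ℓ) hk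

end Pinching

/-! ### The conditional entropy of a measurement outcome against a purification -/

section CondEntropy

open Matrix

/-- Given factorizations `N s i = (C s i)ᴴ * C s i` of POVM elements, the unnormalized state
`∑ i, |i⟩⟨i| ⊗ Bᵢ ρ Bᵢᴴ`, where `Bᵢ = ∑ s, |s⟩ ⊗ C s i`: the measurement is performed coherently
as regards `s`. -/
def coherentOutcome {K S I : Type*} [Fintype K] [DecidableEq I]
    (C : S → I → Matrix K K ℂ) (ρ : Matrix K K ℂ) :
    Matrix ((K × S) × I) ((K × S) × I) ℂ :=
  blockDiagonal fun i => (Matrix.of fun (p : K × S) l => C p.2 i p.1 l) * ρ *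
    (Matrix.of fun (p : K × S) l => C p.2 i p.1 l)ᴴ

lemma coherentOutcome_combo {K S I : Type*} [Fintype K] [DecidableEq I]
    (C : S → I → Matrix K K ℂ) (ρ₀ ρ₁ : Matrix K K ℂ) (a b : ℝ) :
    coherentOutcome C (a • ρ₀ + b • ρ₁) =
      a • coherentOutcome C ρ₀ + b • coherentOutcome C ρ₁ := by
  simp only [coherentOutcome, Matrix.mul_add, Matrix.add_mul, Matrix.mul_smul, Matrix.smul_mul]
  rw [← blockDiagonal_smul, ← blockDiagonal_smul, ← blockDiagonal_add]
  rfl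

variable {K S I : Type*} [Fintype K] [DecidableEq K] [Fintype S] [DecidableEq S]
  [Fintype I] [DecidableEq I]

lemma canonicalPurification_isHermitian (ρ : Matrix K K ℂ) :
    (canonicalPurification ρ).IsHermitian :=
  cfc_predicate Real.sqrt ρ

lemma canonicalPurification_mul_self {ρ : Matrix K K ℂ} (hρ : ρ.PosSemidef) :
    canonicalPurification ρ * canonicalPurification ρ = ρ := by
  have hU : (hρ.1.eigenvectorUnitary : Matrix K K ℂ)ᴴ * (hρ.1.eigenvectorUnitary : Matrix K K ℂ)
    = 1 := hρ.1.eigenvectorUnitary_conjTranspose_mul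
  rw [canonicalPurification, hρ.1.cfc_eq_mul]
  simp only [Matrix.mul_assoc]
  rw [← Matrix.mul_assoc (hρ.1.eigenvectorUnitary : Matrix K K ℂ)ᴴ, hU, Matrix.one_mul,
    ← Matrix.mul_assoc (diagonal _), diagonal_mul_diagonal]
  simp only [← Complex.ofReal_mul, Real.mul_self_sqrt (hρ.eigenvalues_nonneg _)]
  conv_rhs => rw [hρ.1.eq_mul]
  rw [Matrix.mul_assoc]

open scoped MatrixOrder in
lemma Matrix.PosSemidef.exists_eq_conjTranspose_mul_self {A : Matrix K K ℂ}
    (hA : A.PosSemidef) : ∃ B : Matrix K K ℂ, A = Bᴴ * B :=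
  CStarAlgebra.nonneg_iff_eq_star_mul_self.mp hA.nonneg

lemma Matrix.blockDiagonal_posSemidef {m o : Type*} [Fintype m] [DecidableEq o] [Fintype o]
    [DecidableEq m] {M : o → Matrix m m ℂ} (hM : ∀ i, (M i).PosSemidef) :
    (blockDiagonal M).PosSemidef := by
  choose X hX using fun i => (hM i).exists_eq_conjTranspose_mul_self
  have : blockDiagonal M = (blockDiagonal X)ᴴ * blockDiagonal X := by
    rw [blockDiagonal_conjTranspose, ← blockDiagonal_mul]
    congr 1
    ext1 i
    exact hX i
  rw [this]
  exact posSemidef_conjTranspose_mul_self _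

lemma coherentOutcome_posSemidef (C : S → I → Matrix K K ℂ) {ρ : Matrix K K ℂ}
    (hρ : ρ.PosSemidef) : (coherentOutcome C ρ).PosSemidef :=
  blockDiagonal_posSemidef fun _ => hρ.mul_mul_conjTranspose_same _

/-- The spectra of the states of the purifying system are computed on the measured system, where
`H(S|IE)` becomes the entropy gained by dephasing the coherent outcome `S`. -/
lemma cqCondEntropy_eq_relEntropy (C : S → I → Matrix K K ℂ) {ρ : Matrix K K ℂ}
    (hρ : ρ.PosSemidef) :
    cqCondEntropy (fun (s : S) (i : I) =>
        purifierState (canonicalPurification ρ) ((C s i)ᴴ * C s i)) =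
      relEntropy (coherentOutcome C ρ) (pinching (fun p => p.1.2) (coherentOutcome C ρ)) /
        Real.log 2 := by
  set T := canonicalPurification ρ with hT
  have hTh : Tᴴ = T := canonicalPurification_isHermitian ρ
  have hTT : T * T = ρ := canonicalPurification_mul_self hρ
  rw [relEntropy_pinching (coherentOutcome_posSemidef C hρ), cqCondEntropy]
  congr 1
  · set Y : Matrix (K × (S × I)) (K × (S × I)) ℂ :=
      blockDiagonal fun si : S × I => C si.1 si.2 * T with hY
    have h1 : (blockDiagonal fun si : S × I => purifierState T ((C si.1 si.2)ᴴ * C si.1 si.2)) =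
        (Yᴴ * Y)ᵀ := by
      rw [hY, blockDiagonal_conjTranspose, ← blockDiagonal_mul, blockDiagonal_transpose]
      simp only [purifierState, conjTranspose_mul, Matrix.mul_assoc]
    have h2 : pinching (fun p : (K × S) × I => p.1.2) (coherentOutcome C ρ) =
        (Y * Yᴴ).reindex (Equiv.prodAssoc K S I).symm (Equiv.prodAssoc K S I).symm := by
      rw [hY, blockDiagonal_conjTranspose, ← blockDiagonal_mul]
      ext ⟨⟨k, s⟩, i⟩ ⟨⟨k', s'⟩, i'⟩
      have h3 : ∀ s, C s i * T * (C s i * T)ᴴ = C s i * ρ * (C s i)ᴴ := fun s => by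
        rw [conjTranspose_mul, hTh, Matrix.mul_assoc, ← Matrix.mul_assoc T, hTT,
          Matrix.mul_assoc]
      rw [pinching_apply, coherentOutcome]
      simp only [reindex_apply, submatrix_apply, Equiv.symm_symm, Equiv.prodAssoc_apply,
        blockDiagonal_apply, Prod.mk.injEq, h3]
      by_cases hs : s = s' <;> by_cases hi : i = i'
      · subst hs; subst hi
        simp only [if_true, and_self]
        simp [Matrix.mul_apply]
      all_goals simp [hs, hi]
    rw [h1, h2, vnEntropy_transpose (isHermitian_conjTranspose_mul_self Y),
      vnEntropy_reindex _ (isHermitian_mul_conjTranspose_self Y),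
      vnEntropy_conjTranspose_mul_self]
  · set B : I → Matrix (K × S) K ℂ := fun i => Matrix.of fun p l => C p.2 i p.1 l with hB
    set Y : Matrix ((K × S) × I) (K × I) ℂ := blockDiagonal fun i => B i * T with hY
    have hBB : ∀ i, (B i)ᴴ * B i = ∑ s, (C s i)ᴴ * C s i := fun i => by
      ext k l
      simp only [Matrix.mul_apply, Matrix.sum_apply, Fintype.sum_prod_type, conjTranspose_apply,
        hB, of_apply]
      rw [Finset.sum_comm]
    have h1 : (blockDiagonal fun i => ∑ s, purifierState T ((C s i)ᴴ * C s i)) = (Yᴴ * Y)ᵀ := by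
      rw [hY, blockDiagonal_conjTranspose, ← blockDiagonal_mul, blockDiagonal_transpose]
      congr 1
      ext1 i
      rw [conjTranspose_mul, Matrix.mul_assoc, ← Matrix.mul_assoc (B i)ᴴ, hBB]
      simp only [purifierState, ← transpose_sum, Finset.mul_sum, Finset.sum_mul, Matrix.mul_assoc]
    have h2 : coherentOutcome C ρ = Y * Yᴴ := by
      rw [hY, blockDiagonal_conjTranspose, ← blockDiagonal_mul, coherentOutcome]
      congr 1
      ext1 i
      change B i * ρ * (B i)ᴴ = _
      rw [conjTranspose_mul, hTh, Matrix.mul_assoc (B i) T, ← Matrix.mul_assoc T, hTT,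
        Matrix.mul_assoc]
    rw [h1, h2, vnEntropy_transpose (isHermitian_conjTranspose_mul_self Y),
      vnEntropy_conjTranspose_mul_self]

/-- For fixed POVM elements, `H(S|IE)` is convex in the state purified by `E`. -/
theorem cqCondEntropy_purifierState_combo_le {N : S → I → Matrix K K ℂ}
    (hN : ∀ s i, (N s i).PosSemidef) {ρ₀ ρ₁ : Matrix K K ℂ} (h₀ : ρ₀.PosSemidef)
    (h₁ : ρ₁.PosSemidef) {a b : ℝ} (ha : 0 ≤ a) (hb : 0 ≤ b) :
    cqCondEntropy (fun s i => purifierState (canonicalPurification (a • ρ₀ + b • ρ₁)) (N s i)) ≤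
      a * cqCondEntropy (fun s i => purifierState (canonicalPurification ρ₀) (N s i)) +
      b * cqCondEntropy (fun s i => purifierState (canonicalPurification ρ₁) (N s i)) := by
  choose C hC using fun s i => (hN s i).exists_eq_conjTranspose_mul_self
  obtain rfl : N = fun s i => (C s i)ᴴ * C s i := by
    funext s i
    exact hC s i
  rw [cqCondEntropy_eq_relEntropy C h₀, cqCondEntropy_eq_relEntropy C h₁,
    cqCondEntropy_eq_relEntropy C ((h₀.smul ha).add (h₁.smul hb)), coherentOutcome_combo,
    ← mul_div_assoc, ← mul_div_assoc, ← add_div]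
  exact div_le_div_of_nonneg_right (relEntropy_pinching_combo_le _
    (coherentOutcome_posSemidef C h₀) (coherentOutcome_posSemidef C h₁) ha hb)
    (Real.log_nonneg one_le_two)

end CondEntropy

/-! ### States and observed frequencies of a round -/

section States

open Matrix

variable {A A' B : Type*} [Fintype A] [DecidableEq A] [Fintype A'] [DecidableEq A'] [Fintype B]
  [DecidableEq B]

/-- The matrix `(∑ a k, ξ (a, k) |a⟩⟨k|) ⊗ 1_B` from `A'B` to `AB`; conjugation by it takes a Choi
matrix to the output state. -/
def outputOperator (B : Type*) [DecidableEq B] (ξ : A × A' → ℂ) : Matrix (A × B) (A' × B) ℂ :=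
  Matrix.of fun p q => if p.2 = q.2 then ξ (p.1, q.1) else 0

lemma outState_apply (ξ : A × A' → ℂ) (J : Matrix (A' × B) (A' × B) ℂ) (a a' : A) (b b' : B) :
    outState ξ J (a, b) (a', b') =
      ∑ k, ∑ l, ξ (a, k) * J (k, b) (l, b') * star (ξ (a', l)) := by
  simp only [outState, of_apply, Matrix.mul_apply, Fintype.sum_prod_type, reindex_apply,
    submatrix_apply, kroneckerMap_apply, Equiv.prodAssoc_symm_apply, one_apply,
    partialTransposeSnd, vecMulVec_apply]
  refine Finset.sum_congr rfl fun k _ => ?_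
  rw [Finset.sum_eq_single a (fun x _ hx => by simp [hx.symm]) (by simp)]
  refine Finset.sum_congr rfl fun l _ => ?_
  rw [Finset.sum_eq_single b' (fun x _ hx => by simp [hx]) (by simp)]
  simp
  ring

lemma outState_eq_mul (ξ : A × A' → ℂ) (J : Matrix (A' × B) (A' × B) ℂ) :
    outState ξ J = outputOperator B ξ * J * (outputOperator B ξ)ᴴ := by
  ext ⟨a, b⟩ ⟨a', b'⟩
  rw [outState_apply, Finset.sum_comm]
  simp only [Matrix.mul_apply, Fintype.sum_prod_type, outputOperator, of_apply,
    conjTranspose_apply]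
  refine Finset.sum_congr rfl fun l _ => ?_
  rw [Finset.sum_eq_single b' (fun x _ hx => by simp [hx.symm]) (by simp)]
  rw [if_pos rfl, Finset.sum_mul]
  refine Finset.sum_congr rfl fun k _ => ?_
  rw [Finset.sum_eq_single b (fun x _ hx => by simp [hx.symm]) (by simp), if_pos rfl]

lemma outState_combo (ξ : A × A' → ℂ) (J₀ J₁ : Matrix (A' × B) (A' × B) ℂ) (a b : ℝ) :
    outState ξ (a • J₀ + b • J₁) = a • outState ξ J₀ + b • outState ξ J₁ := by
  simp only [outState_eq_mul, Matrix.mul_add, Matrix.add_mul, Matrix.mul_smul, Matrix.smul_mul]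

lemma Matrix.PosSemidef.outState {J : Matrix (A' × B) (A' × B) ℂ} (hJ : J.PosSemidef)
    (ξ : A × A' → ℂ) : (outState ξ J).PosSemidef := by
  rw [outState_eq_mul]
  exact hJ.mul_mul_conjTranspose_same _

lemma trace_outState {ξ : A × A' → ℂ} (hξ : ∑ p, ‖ξ p‖ ^ 2 = 1)
    {J : Matrix (A' × B) (A' × B) ℂ} (hJ : IsChoi J) : (outState ξ J).trace = 1 := by
  have h1 : ∀ k l, ∑ b, J (k, b) (l, b) = if k = l then 1 else 0 := fun k l =>
    (congrFun (congrFun hJ.2 k) l).trans one_apply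
  calc (outState ξ J).trace
      = ∑ a, ∑ k, ∑ l, ξ (a, k) * (∑ b, J (k, b) (l, b)) * star (ξ (a, l)) := by
        simp only [trace, diag_apply, Fintype.sum_prod_type, outState_apply]
        refine Finset.sum_congr rfl fun a _ => ?_
        rw [Finset.sum_comm]
        refine Finset.sum_congr rfl fun k _ => ?_
        rw [Finset.sum_comm]
        refine Finset.sum_congr rfl fun l _ => ?_
        rw [Finset.mul_sum, Finset.sum_mul]
    _ = ∑ a, ∑ k, ((‖ξ (a, k)‖ ^ 2 : ℝ) : ℂ) := by
        refine Finset.sum_congr rfl fun a _ => Finset.sum_congr rfl fun k _ => ?_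
        rw [Finset.sum_eq_single k (fun l _ hl => by simp [h1, hl.symm]) (by simp), h1, if_pos rfl,
          mul_one, RCLike.star_def, Complex.mul_conj']
        push_cast
        rfl
    _ = 1 := by
        rw [← Fintype.sum_prod_type (fun p => ((‖ξ p‖ ^ 2 : ℝ) : ℂ)), ← Complex.ofReal_sum, hξ,
          Complex.ofReal_one]

lemma convex_isChoi {A' B : Type*} [Fintype A'] [DecidableEq A'] [Fintype B] : Convex ℝ {J : Matrix (A' × B) (A' × B) ℂ | IsChoi J} := by
  intro J₀ h₀ J₁ h₁ a b ha hb hab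
  refine ⟨(h₀.1.smul ha).add (h₁.1.smul hb), ?_⟩
  ext k l
  have e₀ := congrFun (congrFun h₀.2 k) l
  have e₁ := congrFun (congrFun h₁.2 k) l
  simp only [of_apply] at e₀ e₁
  simp only [of_apply, Matrix.add_apply, Matrix.smul_apply, Finset.sum_add_distrib,
    ← Finset.smul_sum, e₀, e₁]
  rw [← add_smul, hab, one_smul]

/-- The completely depolarizing channel has a Choi matrix. -/
lemma exists_isChoi [Nonempty B] : ∃ J : Matrix (A' × B) (A' × B) ℂ, IsChoi J := by
  refine ⟨((Fintype.card B : ℝ)⁻¹) • 1, PosSemidef.one.smul (by positivity), ?_⟩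
  ext k l
  have hB : (Fintype.card B : ℂ) ≠ 0 := by simp
  simp only [of_apply, Matrix.smul_apply, one_apply, Prod.mk.injEq, and_true, Finset.sum_const,
    Finset.card_univ]
  split_ifs <;> simp

lemma Matrix.PosSemidef.re_trace_mul_nonneg {n : Type*} [Fintype n] [DecidableEq n]
    {M ρ : Matrix n n ℂ} (hM : M.PosSemidef) (hρ : ρ.PosSemidef) : 0 ≤ (M * ρ).trace.re := by
  obtain ⟨X, rfl⟩ := hM.exists_eq_conjTranspose_mul_self
  rw [Matrix.mul_assoc, trace_mul_comm]
  exact (Complex.le_def.1 (hρ.mul_mul_conjTranspose_same X).trace_nonneg).1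

lemma Matrix.PosSemidef.norm_apply_le_re_trace {n : Type*} [Fintype n] [DecidableEq n]
    {ρ : Matrix n n ℂ} (hρ : ρ.PosSemidef) (p q : n) : ‖ρ p q‖ ≤ ρ.trace.re := by
  obtain ⟨X, rfl⟩ := hρ.exists_eq_conjTranspose_mul_self
  have h1 : (Xᴴ * X).trace.re = ∑ p, ∑ k, ‖X k p‖ ^ 2 := by
    simp only [trace, diag_apply, Matrix.mul_apply, conjTranspose_apply, Complex.re_sum,
      RCLike.star_def, Complex.conj_mul', ← Complex.ofReal_pow, Complex.ofReal_re]
  have h2 : ∀ p, ∑ k, ‖X k p‖ ^ 2 ≤ (Xᴴ * X).trace.re := fun p => by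
    rw [h1]
    exact Finset.single_le_sum (f := fun p => ∑ k, ‖X k p‖ ^ 2)
      (fun p _ => by positivity) (Finset.mem_univ p)
  calc ‖(Xᴴ * X) p q‖ ≤ ∑ k, ‖X k p‖ * ‖X k q‖ := by
        rw [Matrix.mul_apply]
        refine (norm_sum_le _ _).trans (le_of_eq (Finset.sum_congr rfl fun k _ => ?_))
        rw [norm_mul, conjTranspose_apply, norm_star]
    _ ≤ ∑ k, (‖X k p‖ ^ 2 + ‖X k q‖ ^ 2) / 2 := Finset.sum_le_sum fun k _ => by
        nlinarith [sq_nonneg (‖X k p‖ - ‖X k q‖)]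
    _ ≤ (Xᴴ * X).trace.re := by
        rw [← Finset.sum_div, Finset.sum_add_distrib]
        linarith [h2 p, h2 q]

/-- A real linear functional is bounded below on density matrices. -/
lemma exists_le_of_posSemidef_of_trace_eq_one {n : Type*} [Fintype n] [DecidableEq n]
    (f : Matrix n n ℂ →ₗ[ℝ] ℝ) :
    ∃ c : ℝ, ∀ ρ : Matrix n n ℂ, ρ.PosSemidef → ρ.trace = 1 → c ≤ f ρ := by
  refine ⟨-∑ p, ∑ q, (|f (single p q 1)| + |f (single p q Complex.I)|), fun ρ hρ htr => ?_⟩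
  have h1 : f ρ = ∑ p, ∑ q,
      ((ρ p q).re * f (single p q 1) + (ρ p q).im * f (single p q Complex.I)) := by
    conv_lhs => rw [matrix_eq_sum_single ρ]
    simp only [map_sum]
    refine Finset.sum_congr rfl fun p _ => Finset.sum_congr rfl fun q _ => ?_
    rw [← smul_eq_mul, ← smul_eq_mul, ← map_smul, ← map_smul, ← map_add]
    congr 1
    rw [smul_single, smul_single, ← single_add]
    congr 1
    rw [Complex.real_smul, Complex.real_smul, mul_one, Complex.re_add_im]
  rw [h1, neg_le]
  simp only [← Finset.sum_neg_distrib]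
  refine Finset.sum_le_sum fun p _ => Finset.sum_le_sum fun q _ => ?_
  have hn : ‖ρ p q‖ ≤ 1 := by simpa [htr] using hρ.norm_apply_le_re_trace p q
  have h2 : ∀ x y : ℝ, |x| ≤ 1 → -(x * y) ≤ |y| := fun x y hx =>
    (neg_le_abs _).trans (by rw [abs_mul]; exact mul_le_of_le_one_left (abs_nonneg y) hx)
  have h3 := h2 _ (f (single p q 1)) ((Complex.abs_re_le_norm _).trans hn)
  have h4 := h2 _ (f (single p q Complex.I)) ((Complex.abs_im_le_norm _).trans hn)
  linarith

end States

namespace PMRound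

open Matrix

variable {A A' B X Y C I S : Type*}
  [Fintype A] [DecidableEq A] [Fintype A'] [Fintype B] [DecidableEq B] [Fintype X] [Fintype Y]

lemma Φ_combo [DecidableEq C] (P : PMRound A A' B X Y C I S) (ρ₀ ρ₁ : Matrix (A × B) (A × B) ℂ) (a b : ℝ) :
    P.Φ (a • ρ₀ + b • ρ₁) = a • P.Φ ρ₀ + b • P.Φ ρ₁ := by
  ext c
  simp only [Φ, Pi.add_apply, Pi.smul_apply, smul_eq_mul, Finset.mul_sum,
    ← Finset.sum_add_distrib]
  refine Finset.sum_congr rfl fun x _ => Finset.sum_congr rfl fun y _ => ?_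
  split_ifs
  · simp [Matrix.mul_add, trace_add, trace_smul]
  · simp

lemma Φ_ρt_combo [DecidableEq A'] [DecidableEq C] (P : PMRound A A' B X Y C I S)
    (J₀ J₁ : Matrix (A' × B) (A' × B) ℂ) (a b : ℝ) :
    P.Φ (P.ρt (a • J₀ + b • J₁)) = a • P.Φ (P.ρt J₀) + b • P.Φ (P.ρt J₁) := by
  rw [ρt, outState_combo, Φ_combo]
  rfl

lemma Φ_ρt_mem_stdSimplex [DecidableEq A'] [Fintype C] [DecidableEq C]
    (P : PMRound A A' B X Y C I S) {J : Matrix (A' × B) (A' × B) ℂ}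
    (hJ : IsChoi J) : P.Φ (P.ρt J) ∈ stdSimplex ℝ C := by
  constructor
  · intro c
    refine Finset.sum_nonneg fun x _ => Finset.sum_nonneg fun y _ => ?_
    split_ifs
    · exact ((P.MAt_povm.1 x).kronecker (P.MB_povm.1 y)).re_trace_mul_nonneg (hJ.1.outState _)
    · exact le_rfl
  · have h1 : ∑ c, P.Φ (P.ρt J) c = ∑ x, ∑ y, ((P.MAt x ⊗ₖ P.MB y) * P.ρt J).trace.re := by
      simp only [Φ]
      rw [Finset.sum_comm]
      refine Finset.sum_congr rfl fun x _ => ?_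
      rw [Finset.sum_comm]
      refine Finset.sum_congr rfl fun y _ => ?_
      simp
    have h2 : ∑ x, ∑ y, P.MAt x ⊗ₖ P.MB y = 1 := by
      calc ∑ x, ∑ y, P.MAt x ⊗ₖ P.MB y = (∑ x, P.MAt x) ⊗ₖ ∑ y, P.MB y := by
            ext p q
            simp only [Matrix.sum_apply, kroneckerMap_apply, Finset.sum_mul_sum]
        _ = 1 := by rw [P.MAt_povm.2, P.MB_povm.2, one_kronecker_one]
    simp only [h1, ← Complex.re_sum, ← trace_sum, ← Finset.sum_mul]
    rw [h2, Matrix.one_mul, ρt, trace_outState P.ξt_norm hJ, Complex.one_re]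

lemma keyElement_posSemidef [DecidableEq I] [DecidableEq S] (P : PMRound A A' B X Y C I S)
    (s : S) (i : I) :
    (P.keyElement s i).PosSemidef := by
  refine posSemidef_sum _ fun x _ => posSemidef_sum _ fun y _ => ?_
  split_ifs
  · exact (P.MAg_povm.1 x).kronecker (P.MB_povm.1 y)
  · exact PosSemidef.zero

/-- The rate is convex: knowing which of two channels was used can only help the eavesdropper. -/
theorem convexOn_W_ρg [DecidableEq A'] [Fintype I] [DecidableEq I] [Fintype S] [DecidableEq S]
    (P : PMRound A A' B X Y C I S) :
    ConvexOn ℝ {J : Matrix (A' × B) (A' × B) ℂ | IsChoi J} (fun J => P.W (P.ρg J)) := by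
  refine ⟨convex_isChoi, fun J₀ h₀ J₁ h₁ a b ha hb _ => ?_⟩
  have h := mul_le_mul_of_nonneg_left (cqCondEntropy_purifierState_combo_le
    P.keyElement_posSemidef (h₀.1.outState P.ξg) (h₁.1.outState P.ξg) ha hb)
    (sub_nonneg.2 P.γ_le_one)
  simp only [W, ρg, outState_combo, smul_eq_mul]
  linarith

end PMRound

/-! ### The second-order correction and its conjugate -/

namespace PMRound

variable {A A' B X Y C I S : Type*}
  [Fintype A] [DecidableEq A] [Fintype A'] [Fintype B] [DecidableEq B] [Fintype X] [Fintype Y]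
  (P : PMRound A A' B X Y C I S) {α : ℝ}

lemma φ₀_pos (hα₁ : 1 < α) (hα₂ : α < 2) : 0 < P.φ₀ α := by
  have h1 : 0 < α - 1 := by linarith
  have h2 : 0 < 2 - α := by linarith
  have h3 := P.γ_pos
  have h4 := Real.log_pos one_lt_two
  unfold φ₀
  positivity

variable [Fintype S]

lemma φ₁_nonneg (hα₁ : 1 < α) (hα₂ : α < 2) (κ : ℕ) : 0 ≤ P.φ₁ α κ := by
  have h1 : 0 < α - 1 := by linarith
  have h2 : 0 < 2 - α := by linarith
  have h4 := Real.log_pos one_lt_two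
  have h5 : 0 ≤ Real.logb 2 (1 + 2 * (Fintype.card S : ℝ) ^ κ) :=
    Real.logb_nonneg one_lt_two (le_add_of_nonneg_right (by positivity))
  unfold φ₁
  positivity

lemma sFun_eq_max (κ : ℕ) (x : ℝ) :
    P.sFun α κ x = (max 0 (x - P.φ₁ α κ)) ^ 2 / (4 * P.φ₀ α) := by
  unfold sFun
  split_ifs with h
  · rw [max_eq_right (by linarith)]
  · rw [max_eq_left (by linarith)]; simp

lemma sFun_zero (hα₁ : 1 < α) (hα₂ : α < 2) (κ : ℕ) : P.sFun α κ 0 = 0 := by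
  have := P.φ₁_nonneg hα₁ hα₂ κ
  rw [sFun_eq_max, max_eq_left (by linarith)]
  simp

lemma sFun_mono (hα₁ : 1 < α) (hα₂ : α < 2) (κ : ℕ) : Monotone (P.sFun α κ) := by
  intro x y hxy
  have := P.φ₀_pos hα₁ hα₂
  rw [sFun_eq_max, sFun_eq_max]
  gcongr

lemma convexOn_sFun (hα₁ : 1 < α) (hα₂ : α < 2) (κ : ℕ) :
    ConvexOn ℝ Set.univ (P.sFun α κ) := by
  have h0 := P.φ₀_pos hα₁ hα₂
  have h1 : ConvexOn ℝ Set.univ fun x : ℝ => max 0 (x - P.φ₁ α κ) :=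
    (convexOn_const 0 convex_univ).sup
      ((convexOn_id convex_univ).sub (concaveOn_const _ convex_univ))
  have h2 := (h1.pow (fun x _ => le_max_left _ _) 2).smul
    (inv_nonneg.2 (mul_nonneg zero_le_four h0.le))
  refine h2.congr fun x _ => ?_
  rw [sFun_eq_max]
  simp [div_eq_inv_mul]

lemma differentiable_sFun (κ : ℕ) : Differentiable ℝ (P.sFun α κ) := by
  have h1 : ∀ x : ℝ, HasDerivAt (fun x : ℝ => (max 0 x) ^ 2) (2 * max 0 x) x := by
    intro x
    rcases lt_trichotomy x 0 with h | h | h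
    · rw [max_eq_left h.le, mul_zero]
      refine (hasDerivAt_const x (0 : ℝ)).congr_of_eventuallyEq ?_
      filter_upwards [eventually_lt_nhds h] with y hy
      simp [max_eq_left hy.le]
    · subst h
      rw [max_self, mul_zero]
      -- the function is `O(x ^ 2)` at the corner
      rw [hasDerivAt_iff_isLittleO]
      simp only [max_self, sub_zero, smul_zero, ne_eq, OfNat.ofNat_ne_zero, not_false_eq_true,
        zero_pow]
      have h2 : (fun x : ℝ => (max 0 x) ^ 2) =O[nhds 0] fun x : ℝ => x ^ 2 := by
        refine Asymptotics.IsBigO.of_bound 1 (Filter.Eventually.of_forall fun x => ?_)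
        rw [one_mul, norm_pow, norm_pow]
        gcongr
        rw [Real.norm_eq_abs, Real.norm_eq_abs, abs_of_nonneg (le_max_left _ _)]
        exact max_le (abs_nonneg x) (le_abs_self x)
      exact h2.trans_isLittleO (Asymptotics.isLittleO_pow_id one_lt_two)
    · rw [max_eq_right h.le]
      have h2 : HasDerivAt (fun x : ℝ => x ^ 2) (2 * x) x := by simpa using hasDerivAt_pow 2 x
      refine h2.congr_of_eventuallyEq ?_
      filter_upwards [eventually_gt_nhds h] with y hy
      rw [max_eq_right hy.le]
  have h3 : P.sFun α κ = fun x => (max 0 (x - P.φ₁ α κ)) ^ 2 / (4 * P.φ₀ α) :=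
    funext fun x => P.sFun_eq_max κ x
  rw [h3]
  intro x
  exact (((h1 (x - P.φ₁ α κ)).differentiableAt).comp x
    ((differentiableAt_id).sub_const _)).div_const _

/-- The Fenchel–Young inequality for `R ↦ φ₀ R ^ 2 + φ₁ R` and `s`. -/
lemma mul_le_add_sFun (hα₁ : 1 < α) (hα₂ : α < 2) (κ : ℕ) {R x : ℝ} (hR : 0 ≤ R) :
    R * x ≤ P.φ₀ α * R ^ 2 + P.φ₁ α κ * R + P.sFun α κ x := by
  have h0 := P.φ₀_pos hα₁ hα₂
  unfold sFun
  split_ifs with h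
  · have h1 : (x - P.φ₁ α κ) ^ 2 / (4 * P.φ₀ α) - (x - P.φ₁ α κ) * R + P.φ₀ α * R ^ 2 =
        (x - P.φ₁ α κ - 2 * P.φ₀ α * R) ^ 2 / (4 * P.φ₀ α) := by
      field_simp
      ring
    have h2 : 0 ≤ (x - P.φ₁ α κ - 2 * P.φ₀ α * R) ^ 2 / (4 * P.φ₀ α) := by positivity
    linarith
  · nlinarith [mul_nonneg h0.le (sq_nonneg R)]

/-- The case of equality in the Fenchel–Young inequality. -/
lemma mul_eq_add_sFun (hα₁ : 1 < α) (hα₂ : α < 2) (κ : ℕ) {R : ℝ} (hR : 0 ≤ R) :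
    R * (2 * P.φ₀ α * R + P.φ₁ α κ) = P.φ₀ α * R ^ 2 + P.φ₁ α κ * R
      + P.sFun α κ (2 * P.φ₀ α * R + P.φ₁ α κ) := by
  have h0 := P.φ₀_pos hα₁ hα₂
  rw [sFun, if_pos (le_add_of_nonneg_left (by positivity))]
  field_simp
  ring

variable [Fintype C]

lemma iInf_le_iSup_real (g : C → ℝ) : ⨅ c, g c ≤ ⨆ c, g c := by
  cases isEmpty_or_nonempty C
  · simp
  · exact ciInf_le_ciSup (Set.finite_range g).bddBelow (Set.finite_range g).bddAbove

lemma dotProduct_le_range_mul (g lam : C → ℝ) (hlam : ∑ c, lam c = 0) :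
    g ⬝ᵥ lam ≤ ((⨆ c, g c) - ⨅ c, g c) * ((∑ c, |lam c|) / 2) := by
  set M := ⨆ c, g c
  set m := ⨅ c, g c
  have hM : ∀ c, g c ≤ M := fun c => le_ciSup (Set.finite_range g).bddAbove c
  have hm : ∀ c, m ≤ g c := fun c => ciInf_le (Set.finite_range g).bddBelow c
  -- subtracting the midpoint of the range from `g` does not change the left-hand side
  have h1 : g ⬝ᵥ lam = ∑ c, (g c - (M + m) / 2) * lam c := by
    simp only [sub_mul, Finset.sum_sub_distrib, ← Finset.mul_sum, hlam, mul_zero, sub_zero]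
    rfl
  rw [h1, mul_div_assoc', mul_comm, Finset.sum_mul, Finset.sum_div]
  refine Finset.sum_le_sum fun c _ => ?_
  have h2 : |g c - (M + m) / 2| ≤ (M - m) / 2 := by
    rw [abs_le]
    constructor <;> linarith [hM c, hm c]
  calc (g c - (M + m) / 2) * lam c ≤ |g c - (M + m) / 2| * |lam c| := by
        rw [← abs_mul]; exact le_abs_self _
    _ ≤ (M - m) / 2 * |lam c| := by gcongr
    _ = |lam c| * (M - m) / 2 := by ring

/-- Fenchel–Young inequality for `T̂` and its conjugate. -/
lemma dotProduct_le_That_add_sFun (hα₁ : 1 < α) (hα₂ : α < 2) (κ : ℕ) (g lam : C → ℝ)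
    (hlam : ∑ c, lam c = 0) :
    g ⬝ᵥ lam ≤ P.That α κ g + P.sFun α κ ((∑ c, |lam c|) / 2) :=
  (dotProduct_le_range_mul g lam hlam).trans
    (P.mul_le_add_sFun hα₁ hα₂ κ (sub_nonneg.2 (iInf_le_iSup_real g)))

/-- Equality in the Fenchel–Young inequality is attained at a multiple of `e_c - e_d`, where `c`
and `d` are positions of the maximum and the minimum of `g`. -/
lemma exists_dotProduct_eq_That_add_sFun [DecidableEq C] [Nonempty C] (hα₁ : 1 < α) (hα₂ : α < 2) (κ : ℕ)
    (g : C → ℝ) : ∃ lam : C → ℝ,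
      P.That α κ g + P.sFun α κ ((∑ c, |lam c|) / 2) ≤ g ⬝ᵥ lam := by
  obtain ⟨c, hc⟩ := exists_eq_ciSup_of_finite (f := g)
  obtain ⟨d, hd⟩ := exists_eq_ciInf_of_finite (f := g)
  set R := (⨆ c, g c) - ⨅ c, g c with hR
  have hR0 : 0 ≤ R := sub_nonneg.2 (iInf_le_iSup_real g)
  set x := 2 * P.φ₀ α * R + P.φ₁ α κ with hx
  have hx0 : 0 ≤ x := by
    have h0 := P.φ₀_pos hα₁ hα₂
    have h1 := P.φ₁_nonneg hα₁ hα₂ κ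
    positivity
  refine ⟨fun e => (Pi.single c x : C → ℝ) e - (Pi.single d x : C → ℝ) e, ?_⟩
  have h1 : (∑ e, |(Pi.single c x : C → ℝ) e - (Pi.single d x : C → ℝ) e|) / 2 ≤ x := by
    have h2 : ∀ (c e : C), |(Pi.single c x : C → ℝ) e| = (Pi.single c x : C → ℝ) e := fun c e =>
      abs_of_nonneg (by rw [Pi.single_apply]; split_ifs <;> simp [hx0])
    have h3 : ∑ e, |(Pi.single c x : C → ℝ) e - (Pi.single d x : C → ℝ) e| ≤
        ∑ e, ((Pi.single c x : C → ℝ) e + (Pi.single d x : C → ℝ) e) :=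
      Finset.sum_le_sum fun e _ => (abs_sub _ _).trans (by rw [h2, h2])
    rw [Finset.sum_add_distrib, Finset.sum_pi_single', Finset.sum_pi_single'] at h3
    simp only [Finset.mem_univ, if_true] at h3
    linarith
  have h4 : g ⬝ᵥ (fun e => (Pi.single c x : C → ℝ) e - (Pi.single d x : C → ℝ) e) = R * x := by
    change g ⬝ᵥ (Pi.single c x - Pi.single d x) = _
    rw [dotProduct_sub, dotProduct_single, dotProduct_single, hc, hd, ← sub_mul]
  rw [h4, P.mul_eq_add_sFun hα₁ hα₂ κ hR0]
  exact add_le_add le_rfl (P.sFun_mono hα₁ hα₂ κ h1)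

lemma convexOn_sum_abs_div_two : ConvexOn ℝ Set.univ fun lam : C → ℝ => (∑ c, |lam c|) / 2 := by
  refine ⟨convex_univ, fun x _ y _ a b ha hb _ => ?_⟩
  simp only [smul_eq_mul, Pi.add_apply, Pi.smul_apply]
  have h : ∑ c, |a * x c + b * y c| ≤ ∑ c, (a * |x c| + b * |y c|) :=
    Finset.sum_le_sum fun c _ => (abs_add_le _ _).trans (by
      rw [abs_mul, abs_mul, abs_of_nonneg ha, abs_of_nonneg hb])
  rw [Finset.sum_add_distrib, ← Finset.mul_sum, ← Finset.mul_sum] at h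
  linarith

lemma convexOn_sFun_sum_abs (hα₁ : 1 < α) (hα₂ : α < 2) (κ : ℕ) :
    ConvexOn ℝ Set.univ fun lam : C → ℝ => P.sFun α κ ((∑ c, |lam c|) / 2) := by
  refine ⟨convex_univ, fun x _ y _ a b ha hb hab => ?_⟩
  exact (P.sFun_mono hα₁ hα₂ κ (convexOn_sum_abs_div_two.2 (Set.mem_univ x) (Set.mem_univ y)
    ha hb hab)).trans ((P.convexOn_sFun hα₁ hα₂ κ).2 (Set.mem_univ _) (Set.mem_univ _) ha hb hab)

lemma convexOn_sFun_sum (hα₁ : 1 < α) (hα₂ : α < 2) (κ : ℕ) :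
    ConvexOn ℝ Set.univ fun μ : C → ℝ => P.sFun α κ ((∑ c, μ c) / 2) := by
  have h := (P.convexOn_sFun hα₁ hα₂ κ).comp_linearMap
    ((1 / 2 : ℝ) • ∑ c, LinearMap.proj (R := ℝ) (φ := fun _ : C => ℝ) c)
  refine h.congr fun μ _ => ?_
  simp [div_eq_inv_mul]

lemma differentiable_sFun_sum (κ : ℕ) :
    Differentiable ℝ fun μ : C → ℝ => P.sFun α κ ((∑ c, μ c) / 2) :=
  (P.differentiable_sFun κ).comp (by fun_prop)

lemma continuous_sFun_sum_abs (κ : ℕ) :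
    Continuous fun lam : C → ℝ => P.sFun α κ ((∑ c, |lam c|) / 2) :=
  (P.differentiable_sFun κ).continuous.comp (by fun_prop)

end PMRound

/-! ### Lagrange duality with a finite convex penalty -/

/-- Strong duality for the minimization of `F J + h lam` under the constraint `q - Ψ J - lam = 0`
with `Ψ` affine. As `h` is finite on the whole space, the constraint qualification is automatic:
a hyperplane that separates `{(Ψ J, t) | F J ≤ t}` from `{(y, t) | t < r - h (q - y)}` is not
vertical, and its slope is an optimal multiplier. -/
theorem exists_multiplier_of_le_add {E C : Type*} [AddCommGroup E] [Module ℝ E] [Fintype C]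
    {K : Set E} (hK : K.Nonempty) {F : E → ℝ} (hF : ConvexOn ℝ K F) {Ψ : E → C → ℝ}
    (hΨ : ∀ x y, ∀ a b : ℝ, Ψ (a • x + b • y) = a • Ψ x + b • Ψ y)
    {h : (C → ℝ) → ℝ} (hconv : ConvexOn ℝ Set.univ h) (hcont : Continuous h) {q : C → ℝ} {r : ℝ}
    (hr : ∀ x ∈ K, r ≤ F x + h (q - Ψ x)) :
    ∃ g : C → ℝ, ∀ x ∈ K, ∀ lam, r ≤ F x + h lam + g ⬝ᵥ (q - Ψ x - lam) := by
  classical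
  set s : Set ((C → ℝ) × ℝ) := {z | z.2 < r - h (q - z.1)} with hs
  set t : Set ((C → ℝ) × ℝ) := {z | ∃ x ∈ K, z.1 = Ψ x ∧ F x ≤ z.2} with ht
  have hs1 : Convex ℝ s := by
    intro z hz w hw a b ha hb hab
    have h1 := hconv.2 (Set.mem_univ (q - z.1)) (Set.mem_univ (q - w.1)) ha hb hab
    have h2 : a • (q - z.1) + b • (q - w.1) = q - (a • z + b • w).1 := by
      rw [smul_sub, smul_sub, Prod.fst_add, Prod.smul_fst, Prod.smul_fst]
      have : q = a • q + b • q := by rw [← add_smul, hab, one_smul]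
      conv_rhs => rw [this]
      abel
    rw [h2] at h1
    have hz : z.2 < r - h (q - z.1) := hz
    have hw : w.2 < r - h (q - w.1) := hw
    change (a • z + b • w).2 < r - h (q - (a • z + b • w).1)
    simp only [Prod.snd_add, Prod.smul_snd, smul_eq_mul] at h1 ⊢
    have h3 : a * z.2 + b * w.2 < a * (r - h (q - z.1)) + b * (r - h (q - w.1)) := by
      rcases ha.eq_or_lt with h0 | h0
      · have hb1 : b = 1 := by linarith
        simp only [← h0, hb1]
        linarith
      · have h4 := mul_lt_mul_of_pos_left hz h0
        have h5 := mul_le_mul_of_nonneg_left hw.le hb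
        linarith
    have h6 : a * (r - h (q - z.1)) + b * (r - h (q - w.1)) =
        r - (a * h (q - z.1) + b * h (q - w.1)) := by
      linear_combination r * hab
    linarith
  have hs2 : IsOpen s := isOpen_lt continuous_snd (by fun_prop)
  have ht1 : Convex ℝ t := by
    rintro z ⟨x, hx, hzx, hz⟩ w ⟨y, hy, hwy, hw⟩ a b ha hb hab
    refine ⟨a • x + b • y, hF.1 hx hy ha hb hab, ?_, ?_⟩
    · rw [hΨ, ← hzx, ← hwy]; rfl
    · refine (hF.2 hx hy ha hb hab).trans ?_
      simp only [Prod.snd_add, Prod.smul_snd, smul_eq_mul]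
      gcongr
  have hdisj : Disjoint s t := by
    rw [Set.disjoint_left]
    rintro z hz ⟨x, hx, hzx, hz2⟩
    have hz : z.2 < r - h (q - z.1) := hz
    rw [hzx] at hz
    linarith [hr x hx]
  obtain ⟨f, u, hfs, hft⟩ := geometric_hahn_banach_open hs1 hs2 ht1 hdisj
  set β := f (0, 1) with hβ
  set v : C → ℝ := fun c => f (Pi.single c 1, 0) with hv
  have hf : ∀ y τ, f (y, τ) = v ⬝ᵥ y + τ * β := by
    intro y τ
    have h1 : f (y, τ) = f (y, 0) + τ • f (0, 1) := by
      rw [← map_smul, ← map_add]; simp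
    have h2 : f (y, 0) = v ⬝ᵥ y := by
      have h3 : (y, (0 : ℝ)) = ∑ c, y c • ((Pi.single c 1, 0) : (C → ℝ) × ℝ) := by
        ext c
        · simp [Prod.fst_sum, Finset.sum_apply, Pi.single_apply]
        · simp [Prod.snd_sum]
      rw [h3, map_sum]
      simp only [map_smul, smul_eq_mul, dotProduct, hv]
      exact Finset.sum_congr rfl fun c _ => mul_comm _ _
    rw [h1, h2, smul_eq_mul]
  have hfs' : ∀ y, v ⬝ᵥ y + (r - h (q - y)) * β ≤ u := by
    intro y
    have h1 : ContinuousWithinAt (fun τ : ℝ => v ⬝ᵥ y + τ * β) (Set.Iio (r - h (q - y)))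
        (r - h (q - y)) := by fun_prop
    refine le_of_tendsto h1 ?_
    filter_upwards [self_mem_nhdsWithin] with τ hτ
    rw [← hf]
    exact (hfs (y, τ) hτ).le
  have hft' : ∀ x ∈ K, u ≤ v ⬝ᵥ Ψ x + F x * β := fun x hx => by
    rw [← hf]
    exact hft _ ⟨x, hx, rfl, le_rfl⟩
  have hβpos : 0 < β := by
    obtain ⟨x, hx⟩ := hK
    have h1 := hr x hx
    have h2 := hfs (Ψ x, r - h (q - Ψ x) - 1) (by
      change r - h (q - Ψ x) - 1 < r - h (q - Ψ x)
      linarith)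
    rw [hf] at h2
    have h3 := hft' x hx
    by_contra hneg
    nlinarith
  refine ⟨-(β⁻¹ • v), fun x hx lam => ?_⟩
  have h1 := (hfs' (q - lam)).trans (hft' x hx)
  rw [sub_sub_cancel, dotProduct_sub] at h1
  rw [neg_dotProduct, smul_dotProduct, dotProduct_sub, dotProduct_sub, smul_eq_mul]
  have h2 : (r - h lam) ≤ F x + β⁻¹ * (v ⬝ᵥ Ψ x - (v ⬝ᵥ q - v ⬝ᵥ lam)) := by
    have h3 : (r - h lam - F x) ≤ (v ⬝ᵥ Ψ x - (v ⬝ᵥ q - v ⬝ᵥ lam)) / β := by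
      rw [le_div_iff₀ hβpos]
      linarith
    rw [div_eq_inv_mul] at h3
    linarith
  linarith

/-! ### Strong duality for the linearized program -/

namespace PMRound

variable {A A' B X Y C I S : Type*}
  [Fintype A] [DecidableEq A] [Fintype A'] [Fintype B] [DecidableEq B] [Fintype X] [Fintype Y]
  (P : PMRound A A' B X Y C I S) {α : ℝ}

lemma neg_le_and_le_iff_abs_le {lam μ : C → ℝ} : (-μ ≤ lam ∧ lam ≤ μ) ↔ ∀ c, |lam c| ≤ μ c := by
  simp only [abs_le, Pi.le_def, Pi.neg_apply, forall_and]

lemma affineMap_prod_zero_combo {E : Type*} [AddCommGroup E] [Module ℝ E]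
    (L : (E × (C → ℝ)) →ᵃ[ℝ] ℝ) (ρ₀ ρ₁ : E) {a b : ℝ} (hab : a + b = 1) :
    L (a • ρ₀ + b • ρ₁, 0) = a * L (ρ₀, 0) + b * L (ρ₁, 0) := by
  have h := Convex.combo_affine_apply (f := L) (x := (ρ₀, (0 : C → ℝ)))
    (y := (ρ₁, (0 : C → ℝ))) hab
  simpa using h

variable [DecidableEq A']

/-- An affine lower bound bounds the rate from below, uniformly over all channels. -/
lemma exists_le_affineMap (L : (Matrix (A × B) (A × B) ℂ × (C → ℝ)) →ᵃ[ℝ] ℝ) :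
    ∃ b : ℝ, ∀ J : Matrix (A' × B) (A' × B) ℂ, IsChoi J → b ≤ L (P.ρg J, 0) := by
  obtain ⟨b, hb⟩ := exists_le_of_posSemidef_of_trace_eq_one
    (L.linear ∘ₗ LinearMap.inl ℝ (Matrix (A × B) (A × B) ℂ) (C → ℝ))
  refine ⟨b + L 0, fun J hJ => ?_⟩
  have h1 := hb _ (hJ.1.outState P.ξg) (trace_outState P.ξg_norm hJ)
  have h2 : L (P.ρg J, 0) = L.linear (P.ρg J, 0) + L 0 := by
    rw [← vadd_eq_add, ← AffineMap.map_vadd]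
    simp
  rw [h2]
  exact add_le_add h1 le_rfl

variable [Fintype C] [DecidableEq C]

lemma affineMap_prod_apply {E : Type*} [AddCommGroup E] [Module ℝ E]
    (L : (E × (C → ℝ)) →ᵃ[ℝ] ℝ) (ρ : E) (μ : C → ℝ) :
    L (ρ, μ) = L (ρ, 0) + ∑ c, L.linear (0, Pi.single c 1) * μ c := by
  have h1 : ((ρ, μ) : E × (C → ℝ)) = ((0, μ) : E × (C → ℝ)) +ᵥ ((ρ, 0) : E × (C → ℝ)) := by simp
  have h2 : ((0, μ) : E × (C → ℝ)) = ∑ c, μ c • ((0, Pi.single c 1) : E × (C → ℝ)) := by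
    ext c
    · simp [Prod.fst_sum]
    · simp [Prod.snd_sum, Finset.sum_apply, Pi.single_apply]
  rw [h1, AffineMap.map_vadd, h2, map_sum, vadd_eq_add, add_comm]
  simp only [map_smul, smul_eq_mul, mul_comm]

lemma dualSDP_le_rSDP (L : (Matrix (A × B) (A × B) ℂ × (C → ℝ)) →ᵃ[ℝ] ℝ) (qhon g : C → ℝ) :
    P.dualSDP L qhon g ≤ P.rSDP L qhon := by
  refine le_iInf fun J => le_iInf fun lam => le_iInf fun μ => le_iInf fun hJ => le_iInf fun he =>
    le_iInf fun hμ => ?_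
  refine iInf_le_of_le J (iInf_le_of_le lam (iInf_le_of_le μ (iInf_le_of_le hJ
    (iInf_le_of_le hμ ?_))))
  rw [he, dotProduct_zero, add_zero]

/-- Strong duality for the linearized program when its value is finite. Then `L` is nondecreasing in
each `μ c`, so that for given `lam` the optimal `μ` is `|lam|`, and the program has the form covered
by `exists_multiplier_of_le_add`. -/
lemma exists_le_dualSDP [Nonempty B]
    (L : (Matrix (A × B) (A × B) ℂ × (C → ℝ)) →ᵃ[ℝ] ℝ) {qhon : C → ℝ} {r : ℝ}
    (hr : (r : EReal) ≤ P.rSDP L qhon) : ∃ g, (r : EReal) ≤ P.dualSDP L qhon g := by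
  set β : C → ℝ := fun c => L.linear (0, Pi.single c 1) with hβ
  have hL : ∀ ρ μ, L (ρ, μ) = L (ρ, 0) + ∑ c, β c * μ c := affineMap_prod_apply L
  have hfeas : ∀ J : Matrix (A' × B) (A' × B) ℂ, IsChoi J → ∀ μ : C → ℝ,
      (∀ c, |(qhon - P.Φ (P.ρt J)) c| ≤ μ c) → r ≤ L (P.ρg J, 0) + ∑ c, β c * μ c := by
    intro J hJ μ hμ
    rw [← hL]
    refine EReal.coe_le_coe_iff.1 (hr.trans ?_)
    exact iInf_le_of_le J (iInf_le_of_le _ (iInf_le_of_le μ (iInf_le_of_le hJ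
      (iInf_le_of_le (sub_self _) (iInf_le_of_le (neg_le_and_le_iff_abs_le.2 hμ) le_rfl)))))
  -- a negative slope in `μ c` would make the program unbounded
  have hβ0 : ∀ c, 0 ≤ β c := by
    intro c
    by_contra! hc
    obtain ⟨J, hJ⟩ := exists_isChoi (A' := A') (B := B)
    set T := L (P.ρg J, 0) + ∑ e, β e * |(qhon - P.Φ (P.ρt J)) e| with hT
    have h1 : ∀ t : ℝ, 0 ≤ t → r ≤ T + β c * t := by
      intro t ht
      have h2 := hfeas J hJ (fun e => |(qhon - P.Φ (P.ρt J)) e| + (Pi.single c t : C → ℝ) e)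
        fun e => le_add_of_nonneg_right (by rw [Pi.single_apply]; split_ifs <;> simp [ht])
      simp only [mul_add, Finset.sum_add_distrib] at h2
      rw [← add_assoc] at h2
      convert h2 using 2
      change _ = β ⬝ᵥ Pi.single c t
      rw [dotProduct_single]
    have h3 := h1 0 le_rfl
    have h4 := h1 ((T - r + 1) / (-β c)) (div_nonneg (by linarith) (by linarith))
    have h5 : β c * ((T - r + 1) / (-β c)) = -(T - r + 1) := by
      rw [mul_div_assoc', div_neg, mul_div_cancel_left₀ _ hc.ne]
    linarith
  have hconv : ConvexOn ℝ Set.univ fun lam : C → ℝ => ∑ c, β c * |lam c| := by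
    refine ⟨convex_univ, fun x _ y _ a b ha hb _ => ?_⟩
    simp only [smul_eq_mul, Pi.add_apply, Pi.smul_apply, Finset.mul_sum, ← Finset.sum_add_distrib]
    refine Finset.sum_le_sum fun c _ => ?_
    have h1 := mul_le_mul_of_nonneg_left (abs_add_le (a * x c) (b * y c)) (hβ0 c)
    rw [abs_mul, abs_mul, abs_of_nonneg ha, abs_of_nonneg hb] at h1
    linarith
  have hF : ConvexOn ℝ {J : Matrix (A' × B) (A' × B) ℂ | IsChoi J} fun J => L (P.ρg J, 0) :=
    ⟨convex_isChoi, fun J₀ _ J₁ _ a b _ _ hab => by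
      simp only [ρg, outState_combo]
      exact (affineMap_prod_zero_combo L _ _ hab).le⟩
  obtain ⟨g, hg⟩ := exists_multiplier_of_le_add (q := qhon) (r := r) exists_isChoi hF
    P.Φ_ρt_combo hconv (by fun_prop) fun J hJ => hfeas J hJ _ fun c => le_rfl
  refine ⟨g, le_iInf fun J => le_iInf fun lam => le_iInf fun μ => le_iInf fun hJ =>
    le_iInf fun hμ => EReal.coe_le_coe_iff.2 ?_⟩
  rw [neg_le_and_le_iff_abs_le] at hμ
  have h1 : ∑ c, β c * |lam c| ≤ ∑ c, β c * μ c :=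
    Finset.sum_le_sum fun c _ => mul_le_mul_of_nonneg_left (hμ c) (hβ0 c)
  have h2 := hg J hJ lam
  rw [hL]
  linarith

/-! ### The optimal crossover min-tradeoff functions -/

lemma sum_sub_Φ_eq_zero {qhon : C → ℝ} (hqhon : qhon ∈ stdSimplex ℝ C)
    {J : Matrix (A' × B) (A' × B) ℂ} (hJ : IsChoi J) :
    ∑ c, (qhon - P.Φ (P.ρt J)) c = 0 := by
  simp only [Pi.sub_apply, Finset.sum_sub_distrib]
  rw [hqhon.2, (P.Φ_ρt_mem_stdSimplex hJ).2, sub_self]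

variable [Fintype I] [DecidableEq I] [Fintype S] [DecidableEq S]

/-- Probability distributions that no channel produces impose no condition. -/
lemma isCrossoverMinTradeoff_iff (g : C → ℝ) (k : ℝ) :
    P.IsCrossoverMinTradeoff g k ↔
      ∀ J : Matrix (A' × B) (A' × B) ℂ, IsChoi J → g ⬝ᵥ P.Φ (P.ρt J) + k ≤ P.W (P.ρg J) := by
  constructor
  · intro h J hJ
    have h1 := h _ (P.Φ_ρt_mem_stdSimplex hJ)
    have h2 : P.rCross (P.Φ (P.ρt J)) ≤ (P.W (P.ρg J) : EReal) :=
      iInf_le_of_le J (iInf_le_of_le hJ (iInf_le_of_le rfl le_rfl))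
    exact EReal.coe_le_coe_iff.1 (h1.trans h2)
  · rintro h q -
    refine le_iInf fun J => le_iInf fun hJ => le_iInf fun hq => ?_
    rw [← hq]
    exact EReal.coe_le_coe_iff.2 (h J hJ)

/-- A multiplier that certifies the lower bound `r` on the Lagrangian is the gradient of a crossover
min-tradeoff function that attains `r`: the `lam` of equality in the Fenchel–Young inequality turns
the penalty into `-T̂`. -/
lemma exists_isCrossoverMinTradeoff [Nonempty C] (hα₁ : 1 < α) (hα₂ : α < 2) (κ : ℕ)
    {qhon g : C → ℝ} {r : ℝ}
    (h : ∀ J : Matrix (A' × B) (A' × B) ℂ, IsChoi J → ∀ lam : C → ℝ,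
      r ≤ P.W (P.ρg J) + P.sFun α κ ((∑ c, |lam c|) / 2) +
        g ⬝ᵥ (qhon - P.Φ (P.ρt J) - lam)) :
    ∃ k : ℝ, P.IsCrossoverMinTradeoff g k ∧ r ≤ g ⬝ᵥ qhon + k - P.That α κ g := by
  refine ⟨r - g ⬝ᵥ qhon + P.That α κ g, (P.isCrossoverMinTradeoff_iff g _).2 fun J hJ => ?_,
    by linarith⟩
  obtain ⟨lam, hlam⟩ := P.exists_dotProduct_eq_That_add_sFun hα₁ hα₂ κ g
  have h1 := h J hJ lam
  rw [dotProduct_sub, dotProduct_sub] at h1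
  linarith

/-- The value of the dual program with `lam = qhon - Φ[ρ^t_J]` eliminated. The lower bound on `r_best`
is strong duality, the upper bound the Fenchel–Young inequality. -/
theorem rBest_eq_iInf [Nonempty B] (hα₁ : 1 < α) (hα₂ : α < 2) (κ : ℕ) {qhon : C → ℝ}
    (hqhon : qhon ∈ stdSimplex ℝ C) :
    P.rBest α κ qhon = ⨅ (J : Matrix (A' × B) (A' × B) ℂ) (_ : IsChoi J),
      ((P.W (P.ρg J) + P.sFun α κ ((∑ c, |(qhon - P.Φ (P.ρt J)) c|) / 2) : ℝ) : EReal) := by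
  apply le_antisymm
  · refine iSup_le fun g => iSup_le fun k => iSup_le fun hg => le_iInf fun J => le_iInf fun hJ =>
      EReal.coe_le_coe_iff.2 ?_
    have h1 := (P.isCrossoverMinTradeoff_iff g k).1 hg J hJ
    have h2 := P.dotProduct_le_That_add_sFun hα₁ hα₂ κ g _ (P.sum_sub_Φ_eq_zero hqhon hJ)
    rw [dotProduct_sub] at h2
    linarith
  · have : Nonempty C := by
      by_contra hC
      rw [not_nonempty_iff] at hC
      simpa using hqhon.2
    refine EReal.ge_of_forall_gt_iff_ge.1 fun r hr => ?_
    have hr' : ∀ J ∈ {J : Matrix (A' × B) (A' × B) ℂ | IsChoi J},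
        r ≤ P.W (P.ρg J) + P.sFun α κ ((∑ c, |(qhon - P.Φ (P.ρt J)) c|) / 2) := fun J hJ =>
      EReal.coe_le_coe_iff.1 (hr.le.trans (iInf₂_le J hJ))
    obtain ⟨g, hg⟩ := exists_multiplier_of_le_add (h := fun lam =>
      P.sFun α κ ((∑ c, |lam c|) / 2)) exists_isChoi P.convexOn_W_ρg
      P.Φ_ρt_combo (P.convexOn_sFun_sum_abs hα₁ hα₂ κ) (P.continuous_sFun_sum_abs κ) hr'
    obtain ⟨k, hk, hrk⟩ := P.exists_isCrossoverMinTradeoff hα₁ hα₂ κ hg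
    exact le_iSup_of_le g (le_iSup_of_le k (le_iSup_of_le hk (EReal.coe_le_coe_iff.2 hrk)))

/-- For every gradient, the constant can be chosen so as to obtain a crossover min-tradeoff
function, provided that there is an affine lower bound. -/
lemma IsAffineLowerBound.exists_isCrossoverMinTradeoff (hα₁ : 1 < α) (hα₂ : α < 2) {κ : ℕ}
    {L : (Matrix (A × B) (A × B) ℂ × (C → ℝ)) →ᵃ[ℝ] ℝ} (hL : P.IsAffineLowerBound α κ L)
    (g : C → ℝ) : ∃ k, P.IsCrossoverMinTradeoff g k := by
  obtain ⟨b, hb⟩ := P.exists_le_affineMap L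
  refine ⟨b - ∑ c, |g c|, (P.isCrossoverMinTradeoff_iff g _).2 fun J hJ => ?_⟩
  have h1 := hL J 0 hJ le_rfl
  simp only [Pi.zero_apply, Finset.sum_const_zero, zero_div, P.sFun_zero hα₁ hα₂, add_zero] at h1
  have h2 := P.Φ_ρt_mem_stdSimplex hJ
  have h3 : g ⬝ᵥ P.Φ (P.ρt J) ≤ ∑ c, |g c| := by
    refine Finset.sum_le_sum fun c _ => ?_
    have h4 : P.Φ (P.ρt J) c ≤ 1 := by
      rw [← h2.2]
      exact Finset.single_le_sum (fun e _ => h2.1 e) (Finset.mem_univ c)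
    calc g c * P.Φ (P.ρt J) c ≤ |g c| * P.Φ (P.ρt J) c :=
          mul_le_mul_of_nonneg_right (le_abs_self _) (h2.1 c)
      _ ≤ |g c| := mul_le_of_le_one_right (abs_nonneg _) h4
  linarith [hb J hJ]

theorem IsAffineLowerBound.optimalDual [Nonempty B] (hα₁ : 1 < α) (hα₂ : α < 2) {κ : ℕ}
    {L : (Matrix (A × B) (A × B) ℂ × (C → ℝ)) →ᵃ[ℝ] ℝ} (hL : P.IsAffineLowerBound α κ L)
    {qhon : C → ℝ} (hqhon : qhon ∈ stdSimplex ℝ C) :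
    (∃ g, P.IsOptimalDual L qhon g) ∧
      ∀ g, P.IsOptimalDual L qhon g →
        P.dualSDP L qhon g = P.rSDP L qhon ∧
        ∃ k : ℝ, P.IsCrossoverMinTradeoff g k ∧
          P.rSDP L qhon ≤ ((g ⬝ᵥ qhon + k - P.That α κ g : ℝ) : EReal) := by
  have : Nonempty C := by
    by_contra hC
    rw [not_nonempty_iff] at hC
    simpa using hqhon.2
  have hweak := P.dualSDP_le_rSDP L qhon
  have htop : P.rSDP L qhon ≠ ⊤ := by
    obtain ⟨J, hJ⟩ := exists_isChoi (A' := A') (B := B)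
    refine ne_of_lt (lt_of_le_of_lt (iInf_le_of_le J (iInf_le_of_le _ (iInf_le_of_le
      (fun c => |(qhon - P.Φ (P.ρt J)) c|) (iInf_le_of_le hJ (iInf_le_of_le (sub_self _)
      (iInf_le_of_le (neg_le_and_le_iff_abs_le.2 fun c => le_rfl) le_rfl))))))
      (EReal.coe_lt_top _))
  by_cases hbot : P.rSDP L qhon = ⊥
  · have h1 : ∀ g, P.dualSDP L qhon g = ⊥ := fun g => le_bot_iff.1 (hbot ▸ hweak g)
    refine ⟨⟨0, fun g' => by rw [h1, h1]⟩, fun g _ => ⟨by rw [h1, hbot], ?_⟩⟩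
    obtain ⟨k, hk⟩ := hL.exists_isCrossoverMinTradeoff P hα₁ hα₂ g
    exact ⟨k, hk, hbot ▸ bot_le⟩
  · set r := (P.rSDP L qhon).toReal with hr
    have hr' : (r : EReal) = P.rSDP L qhon := EReal.coe_toReal htop hbot
    obtain ⟨g₀, hg₀⟩ := P.exists_le_dualSDP L hr'.le
    refine ⟨⟨g₀, fun g' => (hweak g').trans (hr' ▸ hg₀)⟩, fun g hg => ?_⟩
    have hle : P.rSDP L qhon ≤ P.dualSDP L qhon g := (hr' ▸ hg₀).trans (hg g₀)
    refine ⟨(hweak g).antisymm hle, ?_⟩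
    obtain ⟨k, hk, hrk⟩ := P.exists_isCrossoverMinTradeoff hα₁ hα₂ κ (qhon := qhon) (g := g)
      (r := r) fun J hJ lam => by
        have h1 : P.dualSDP L qhon g ≤ ((L (P.ρg J, fun c => |lam c|) +
            g ⬝ᵥ (qhon - P.Φ (P.ρt J) - lam) : ℝ) : EReal) :=
          iInf_le_of_le J (iInf_le_of_le lam (iInf_le_of_le _ (iInf_le_of_le hJ
            (iInf_le_of_le (neg_le_and_le_iff_abs_le.2 fun c => le_rfl) le_rfl))))
        have h2 := EReal.coe_le_coe_iff.1 (hr'.le.trans (hle.trans h1))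
        have h3 := hL J (fun c => |lam c|) hJ fun c => abs_nonneg _
        linarith
    exact ⟨k, hk, hr' ▸ EReal.coe_le_coe_iff.2 hrk⟩

end PMRound

end

theorem mainTheorem2 {A A' B X Y C I S : Type*}
    [Fintype A] [DecidableEq A] [Fintype A'] [DecidableEq A']
    [Fintype B] [DecidableEq B] [Nonempty B]
    [Fintype X] [Fintype Y] [Fintype C] [DecidableEq C]
    [Fintype I] [DecidableEq I] [Fintype S] [DecidableEq S]
    (P : PMRound A A' B X Y C I S)
    (α : ℝ) (hα₁ : 1 < α) (hα₂ : α < 2) (κ : ℕ)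
    (qhon : C → ℝ) (hqhon : qhon ∈ stdSimplex ℝ C) :
    -- the first program has value `r_best`, and is convex
    (P.rBest α κ qhon =
        ⨅ (J : Matrix (A' × B) (A' × B) ℂ) (lam : C → ℝ) (_ : IsChoi J)
          (_ : qhon - P.Φ (P.ρt J) - lam = 0),
          (P.W (P.ρg J) : EReal) + P.ThatConj α κ lam) ∧
    ConvexOn ℝ {J : Matrix (A' × B) (A' × B) ℂ | IsChoi J} (fun J => P.W (P.ρg J)) ∧
    ConvexOn ℝ {lam : C → ℝ | ∑ c, lam c = 0} (fun lam => P.sFun α κ ((∑ c, |lam c|) / 2)) ∧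
    -- so has the second program; the second term of its objective is convex and differentiable
    (P.rBest α κ qhon =
        ⨅ (J : Matrix (A' × B) (A' × B) ℂ) (lam : C → ℝ) (μ : C → ℝ) (_ : IsChoi J)
          (_ : qhon - P.Φ (P.ρt J) - lam = 0) (_ : -μ ≤ lam ∧ lam ≤ μ),
          ((P.W (P.ρg J) + P.sFun α κ ((∑ c, μ c) / 2) : ℝ) : EReal)) ∧
    ConvexOn ℝ Set.univ (fun μ : C → ℝ => P.sFun α κ ((∑ c, μ c) / 2)) ∧
    Differentiable ℝ (fun μ : C → ℝ => P.sFun α κ ((∑ c, μ c) / 2)) ∧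
    -- the optimal dual solutions of the linearized program
    (∀ L : (Matrix (A × B) (A × B) ℂ × (C → ℝ)) →ᵃ[ℝ] ℝ, P.IsAffineLowerBound α κ L →
      (∃ g, P.IsOptimalDual L qhon g) ∧
      ∀ g, P.IsOptimalDual L qhon g →
        P.dualSDP L qhon g = P.rSDP L qhon ∧
        ∃ k : ℝ, P.IsCrossoverMinTradeoff g k ∧
          P.rSDP L qhon ≤ ((g ⬝ᵥ qhon + k - P.That α κ g : ℝ) : EReal)) := by
  refine ⟨?_, P.convexOn_W_ρg, (P.convexOn_sFun_sum_abs hα₁ hα₂ κ).subset (Set.subset_univ _) ?_,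
    ?_, P.convexOn_sFun_sum hα₁ hα₂ κ, P.differentiable_sFun_sum κ,
    fun L hL => hL.optimalDual P hα₁ hα₂ hqhon⟩
  · rw [P.rBest_eq_iInf hα₁ hα₂ κ hqhon]
    refine iInf_congr fun J => le_antisymm ?_ ?_
    · refine le_iInf fun lam => le_iInf fun hJ => le_iInf fun he => iInf_le_of_le hJ ?_
      rw [← sub_eq_zero.1 he, PMRound.ThatConj, if_pos (P.sum_sub_Φ_eq_zero hqhon hJ), EReal.coe_add]
    · refine le_iInf fun hJ => iInf_le_of_le _ (iInf_le_of_le hJ (iInf_le_of_le (sub_self _) ?_))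
      rw [PMRound.ThatConj, if_pos (P.sum_sub_Φ_eq_zero hqhon hJ), EReal.coe_add]
  · intro x hx y hy a b _ _ _
    have hx : ∑ c, x c = 0 := hx
    have hy : ∑ c, y c = 0 := hy
    simp [Finset.sum_add_distrib, ← Finset.mul_sum, hx, hy]
  · rw [P.rBest_eq_iInf hα₁ hα₂ κ hqhon]
    refine iInf_congr fun J => le_antisymm ?_ ?_
    · refine le_iInf fun lam => le_iInf fun μ => le_iInf fun hJ => le_iInf fun he =>
        le_iInf fun hμ => iInf_le_of_le hJ (EReal.coe_le_coe_iff.2 ?_)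
      rw [PMRound.neg_le_and_le_iff_abs_le, ← sub_eq_zero.1 he] at hμ
      refine add_le_add le_rfl (P.sFun_mono hα₁ hα₂ κ ?_)
      gcongr with c
      exact hμ c
    · exact le_iInf fun hJ => iInf_le_of_le _ (iInf_le_of_le
        (fun c => |(qhon - P.Φ (P.ρt J)) c|) (iInf_le_of_le hJ (iInf_le_of_le (sub_self _)
        (iInf_le_of_le (PMRound.neg_le_and_le_iff_abs_le.2 fun c => le_rfl) le_rfl))))
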